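/- **Setting.** Let $\Gamma_{v_0}$ be a finite tree with vertices $v_0,v_1,\dots,v_s$, integer weights $m_1,\dots,m_s$ on $v_1,\dots,v_s$, and an unweighted marked vertex $v_0$. Let $\Gamma=\Gamma_{v_0}\setminus\{v_0\}$, with weight vector $m$ and adjacency matrix $M$ (weights on the diagonal, $1$ for each edge). For $m_0\in\mathbb Z$ let $\Gamma_{v_0,m_0}$ be $\Gamma_{v_0}$ with weight $m_0$ on $v_0$, and let $M_{v_0,m_0}$ be its adjacency matrix, assumed negative definite. Let $\delta_v$ be the degree of $v$ in $\Gamma_{v_0}$, $u=(1,\dots,1)$, $\lambda\in\mathbb Z^s$ the indicator vector of the neighbours of $v_0$, $\mathsf{sf}=\lambda^{T}M^{-1}\lambda$, $\Sigma=(1,-M^{-1}\lambda)$, $p=\Sigma^2=\Sigma^TM_{v_0,m_0}\Sigma=m_0-\mathsf{sf}$. Let $\varepsilon\in\{\pm1\}$, let $\mathcal R$ be a commutative ring and $W=\{W_n:\mathbb Z\to\mathcal R\}_{n\ge0}$ an admissible family: $W_2(0)=1$, $W_2(i)=0$ for $i\ne0$, and $W_n(i+1)-W_n(i-1)=W_{n-1}(i)$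 for $n\ge1$. Powers are expanded by $(t^{-1/2}z-t^{1/2}z^{-1})^{2-n}=\sum_{j\in\mathbb Z}W_n(-j)t^{-j/2}z^j$, and $\oint\frac{dz}{2\pi iz}$ takes the constant term. **Graded roots.** For a weighted forest $G$ with $r$ vertices, weights $m_G$ and negative definite adjacency matrix $M_G$, put $\mathrm{Char}(G)=m_G+2\mathbb Z^r$, and let $\mathrm{spin}^c(G)$ be the set of classes $[k]=k+2M_G\mathbb Z^r$, $k\in\mathrm{Char}(G)$. Put $K^2=K^TM_G^{-1}K$ and $h_U(K)=(K^2+r)/4$. Join $K$ and $K\pm2M_Ge_i$ by an edge. The graded root $R(G,[k])$ has as nodes in grading $h\in2\mathbb Z+h_U(k)$ the connected components of $\{K\in[k]:h_U(K)\ge h\}$; components $C$ in grading $h$ and $C'$ in grading $h-2$ are joined if $C\subset C'$. * The weighted graded root $R_\varepsilon(\Gamma_{v_0,m_0},\mathfrak t,W)$ is $R(\Gamma_{v_0,m_0},\mathfrak t)$ with the weight of $C$ equal to $$\sum_{L\in C}\Big(\prod_vW_{\delta_v}\big((L-\varepsilon M_{v_0,m_0}u)_v\big)\Big)\,q^{-\frac{3(s+1)+\sum_vm_v+(L-\varepsilon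 M_{v_0,m_0}u)^2}{4}}\,t^{\frac{L^Tu-\varepsilon u^TM_{v_0,m_0}u}{2}}.$$ * The weighted graded root $R_\varepsilon(\Gamma_{v_0},\mathfrak s,W)$ of the knot complement is $R(\Gamma,\mathfrak s)$ with the weight of $C$ equal to $$(t^{-1/2}z-t^{1/2}z^{-1})^{1-\delta_0}\sum_{K\in C}\Big(\prod_{i=1}^sW_{\delta_i}\big((K-\varepsilon(Mu+\lambda))_i\big)\Big)q^{\xi(K)}z^{\zeta(K)}t^{\theta(K)},$$ $$\xi(K)=-\tfrac14\Big(3s+\sum_{v}\delta_v+2\sum_{v\ne v_0}m_v+2\,\mathsf{sf}\Big)-\tfrac14K^2+\tfrac{\varepsilon}{2}K^TM^{-1}\lambda+\tfrac{\varepsilon}{2}K^Tu,$$ $$\zeta(K)=\lambda^TM^{-1}K-\varepsilon\,\mathsf{sf}-\varepsilon\delta_0,\qquad \theta(K)=\tfrac12\Big(K^Tu-\varepsilon\sum_{v\ne v_0}(\delta_v+m_v)\Big).$$ * Let $h_V(K)=h_U(K+2\lambda)$. The weighted bigraded root $R^{\rm bi}_\varepsilon(\Gamma_{v_0},[k],W)$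 has as nodes in bigrading $(i,j)\in(2\mathbb Z+h_U(k))\times(2\mathbb Z+h_V(k))$ the components $C$ of $\{K\in[k]:h_U(K)\ge i,\ h_V(K)\ge j\}$. Nodes whose bigradings differ by $2$ in exactly one entry and agree in the other are joined if one of the components contains the other, the one in the higher bigrading being contained in the other. Let $C^U$ (resp. $C^V$) be the component of $\{h_U\ge i\}$ (resp. $\{h_V\ge j\}$) in $[k]$ containing $C$. The weight of $C$ is the weight of $C^U$ in $R_\varepsilon(\Gamma_{v_0},[k],W)$, and the coordinate of $C$ is the pair $(\eta_1,\eta_2)$ of the node $\eta_1=C^U$ of $R(\Gamma,[k])$ in grading $i$ and the node $\eta_2=C^V+2\lambda$ of $R(\Gamma,[k+2\lambda])$ in grading $j$. **Slices.** For $L\in\mathrm{Char}(\Gamma_{v_0,m_0})$ let $a(L)=\frac12(L^T\Sigma+\Sigma^2)$. For $\mathfrak t\in\mathrm{spin}^c(\Gamma_{v_0,m_0})$ let $\mathcal A(\mathfrak t)=\{a(L):L\in\mathfrak t\}$, a coset of $p\mathbb Z$ in $\mathbb Q$. For $a\in\mathcal A(\mathfrak t)$ let $\mathfrak t_a\in\mathrm{spin}^c(\Gamma)$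 be the class of $L|_\Gamma$ for any $L\in\mathfrak t$ with $a(L)=a$; then $\mathfrak t_{a+p}=\mathfrak t_a+2\lambda$. Let $\sigma(a)=-\frac1p(a-\frac p2)^2-\frac14$, and let $\mathcal L_p^{(a,\varepsilon)}$ be the linear operator $$\mathcal L_p^{(a,\varepsilon)}[f]=\oint\frac{dz}{2\pi iz}\,(t^{-1/2}z-t^{1/2}z^{-1})\,f\;z^{2(a-\frac{1+\varepsilon}2p)}\,q^{\frac{-3-p}4}\,q^{-\frac1p(a-\frac{1+\varepsilon}2p)^2}.$$ **Theorem.** For every $\mathfrak t\in\mathrm{spin}^c(\Gamma_{v_0,m_0})$ the weighted graded root $R_\varepsilon(\Gamma_{v_0,m_0},\mathfrak t,W)$ is determined by the weighted bigraded roots $R^{\rm bi}_\varepsilon(\Gamma_{v_0},\mathfrak t_a,W)$, $a\in\mathcal A(\mathfrak t)$, together with the coordinates of their nodes, as follows. 0. Each $R_\varepsilon(\Gamma_{v_0},\mathfrak t_a,W)$ is obtained from $R^{\rm bi}_\varepsilon(\Gamma_{v_0},\mathfrak t_a,W)$ by contracting all edges in the $V$-direction (along which the weight is constant), the class of a node being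 its first coordinate. 1. Take the weighted graded graph $\bigsqcup_{a\in\mathcal A(\mathfrak t)}\mathcal L_p^{(a,\varepsilon)}\big[R_\varepsilon(\Gamma_{v_0},\mathfrak t_a,W)\big]\{-\sigma(a)\}$, where $\{d\}$ shifts the grading up by $d$ and $\mathcal L_p^{(a,\varepsilon)}$ is applied to the individual weights. 2. Identify a node $\eta_1$ of the slice $a$ with a node $\eta_2$ of the slice $a+p$ whenever they are in the same grading and some node of the bigraded root of $(\Gamma_{v_0},\mathfrak t_a)$ has coordinate $(\eta_1,\eta_2)$. Add up the weights of identified nodes (each node of the result comes from finitely many nodes) and keep one edge between any two nodes joined by several. The result is isomorphic, as a graph with gradings and weights, to $R_\varepsilon(\Gamma_{v_0,m_0},\mathfrak t,W)$. **Surgery formula for the $q$-series.** Suppose moreover that $\det M=\pm1$ (the ambient $3$-manifold is an integer homology sphere). Put $$\widehat Z_{\mathfrak t}(q,t)=q^{-\frac{3(s+1)+\sum_vm_v}4}\sum_{\ell+M_{v_0,m_0}u\in\mathfrak t}\Big(\prod_vW_{\delta_v}(\ell_v)\,t^{\ell_v/2}\Big)q^{-\frac{\ell^TM_{v_0,m_0}^{-1}\ell}4},$$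 $$\widehat Z(z,q,t)=(t^{-1/2}z-t^{1/2}z^{-1})^{1-\delta_0}\,q^{-\frac{3s+\sum_{v\ne v_0}m_v+\mathsf{sf}}4}\sum_{\ell}\Big(\prod_{i=1}^sW_{\delta_i}(\ell_i)\,t^{\ell_i/2}\Big)q^{-\frac{\ell^TM^{-1}\ell}4}z^{\lambda^TM^{-1}\ell},$$ the last sum being over the unique class $\ell\in b+2M\mathbb Z^s$ with $b\in(\delta_1,\dots,\delta_s)+2\mathbb Z^s$. Then $$\widehat Z_{\mathfrak t}(q,t)=\sum_{a\in\mathcal A(\mathfrak t)}\mathcal L_p^{(a,\varepsilon)}\big[\widehat Z(z,q,t)\big],$$ where only finitely many $a$ contribute to each coefficient. For $\varepsilon=-1$, and with $W$ the family given by half the sum of the expansions of $(z-z^{-1})^{2-n}$ in powers of $z$ and of $z^{-1}$ (so that the series are the BPS $q$-series), this is Gukov and Manolescu's surgery formula. -/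

import Mathlib

open Matrix

noncomputable section

universe u v

/-! ## Admissible families and formal series -/

/-- Admissible families `W = {W_n : ℤ → R}_{n ≥ 0}`. -/
structure IsAdmissible {R : Type v} [CommRing R] (W : ℕ → ℤ → R) : Prop where
  two_zero : W 2 0 = 1
  two_ne_zero : ∀ i : ℤ, i ≠ 0 → W 2 i = 0
  recurrence : ∀ (n : ℕ) (i : ℤ), W (n + 1) (i + 1) - W (n + 1) (i - 1) = W n i

/-- The family of the BPS `q`-series: `What n (-j)` is the coefficient of `z ^ j` in one half of the
sum of the expansions of `(z - z⁻¹) ^ (2 - n)` in powers of `z` (for `|z| < 1`) and in powers of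
`x = z⁻¹` (for `|z| > 1`). A power in the field of Laurent series in one variable is exactly the
expansion in powers of that variable. -/
def What (n : ℕ) (i : ℤ) : ℚ :=
  (((HahnSeries.single (1 : ℤ) (1 : ℚ) - HahnSeries.single (-1 : ℤ) (1 : ℚ) : LaurentSeries ℚ) ^
      (2 - (n : ℤ))).coeff (-i) +
    ((HahnSeries.single (-1 : ℤ) (1 : ℚ) - HahnSeries.single (1 : ℤ) (1 : ℚ) : LaurentSeries ℚ) ^
      (2 - (n : ℤ))).coeff i) / 2

theorem What_isAdmissible : IsAdmissible What where
  two_zero := by simp [What, HahnSeries.coeff_one]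
  two_ne_zero i hi := by simp [What, HahnSeries.coeff_one, hi]
  recurrence n i := by
    have key : ∀ (y : LaurentSeries ℚ), y ≠ 0 →
        y ^ (2 - (n : ℤ)) = y * y ^ (2 - ((n + 1 : ℕ) : ℤ)) := by
      intro y hy
      rw [← zpow_one_add₀ hy]
      congr 1
      push_cast
      ring
    have h1 : (HahnSeries.single (1 : ℤ) (1 : ℚ) - HahnSeries.single (-1 : ℤ) (1 : ℚ) :
        LaurentSeries ℚ) ≠ 0 := by
      intro h
      have := congrArg (fun f : LaurentSeries ℚ => f.coeff 1) h
      simp at this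
    have h2 : (HahnSeries.single (-1 : ℤ) (1 : ℚ) - HahnSeries.single (1 : ℤ) (1 : ℚ) :
        LaurentSeries ℚ) ≠ 0 := by
      intro h
      have := congrArg (fun f : LaurentSeries ℚ => f.coeff 1) h
      simp at this
    unfold What
    rw [key _ h1, key _ h2, sub_mul, sub_mul]
    simp only [HahnSeries.coeff_sub, HahnSeries.coeff_single_mul, one_mul]
    have e1 : -i - 1 = -(i + 1) := by ring
    have e2 : -i - -1 = -(i - 1) := by ring
    have e3 : i - -1 = i + 1 := by ring
    rw [e1, e2, e3]
    ring

/-- Formal sums of monomials `q ^ x t ^ y` with rational exponents and coefficients in `R`, given by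
their coefficients. The Laurent polynomials are the elements with finite support. -/
abbrev QT (R : Type v) : Type v := ℚ × ℚ → R

/-- Formal sums of powers `z ^ r` with rational exponents and coefficients in `QT R`. -/
abbrev ZQT (R : Type v) : Type v := ℚ → QT R

/-- The monomial `c q ^ x t ^ y`. -/
def QT.monomial {R : Type v} [CommRing R] (x y : ℚ) (c : R) : QT R := Pi.single (x, y) c

/-- Multiplication by the monomial `q ^ x t ^ y`. -/
def QT.shift {R : Type v} (x y : ℚ) (f : QT R) : QT R := fun e => f (e.1 - x, e.2 - y)

/-- The expansion `(t^(-1/2) z - t^(1/2) z⁻¹) ^ (2 - n) = ∑_j W_n (-j) t ^ (-j/2) z ^ j`,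
where `j` runs over the integers. -/
def expansion {R : Type v} [CommRing R] (W : ℕ → ℤ → R) (n : ℕ) : ZQT R := fun r =>
  if r.den = 1 then QT.monomial 0 (-r / 2) (W n (-r.num)) else 0

/-- The Laplace transform `L_p^{(a, ε)}`: with `c = a - (1 + ε) p / 2`, the `z`-constant term of
`(t^(-1/2) z - t^(1/2) z⁻¹) f z ^ (2c) q ^ ((-3-p)/4 - c^2/p)`. -/
def laplace {R : Type v} [CommRing R] (p a : ℚ) (ε : ℤ) (f : ZQT R) : QT R :=
  let c : ℚ := a - (1 + ε) / 2 * p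
  let x : ℚ := -(1 / p) * c ^ 2 + (-3 - p) / 4
  QT.shift x (-1 / 2) (f (-2 * c - 1)) - QT.shift x (1 / 2) (f (-2 * c + 1))

/-! ## Weighted graded graphs -/

/-- A graph with a rational grading and a weight in `X` at each node. -/
structure WeightedGradedGraph (X : Type v) where
  Node : Type u
  graph : SimpleGraph Node
  grading : Node → ℚ
  weight : Node → X

namespace WeightedGradedGraph

variable {X : Type v} {Y : Type v}

/-- Isomorphisms of weighted graded graphs. -/
structure Iso (G : WeightedGradedGraph.{u, v} X) (H : WeightedGradedGraph.{u, v} X) where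
  toIso : G.graph ≃g H.graph
  grading_eq : ∀ x, H.grading (toIso x) = G.grading x
  weight_eq : ∀ x, H.weight (toIso x) = G.weight x

/-- Upward grading shift `G{d}`. -/
def shift (G : WeightedGradedGraph.{u, v} X) (d : ℚ) : WeightedGradedGraph.{u, v} X :=
  { G with grading := fun x => G.grading x + d }

/-- Apply a map to the individual weights. -/
def mapWeight (G : WeightedGradedGraph.{u, v} X) (f : X → Y) : WeightedGradedGraph.{u, v} Y where
  Node := G.Node
  graph := G.graph
  grading := G.grading
  weight := fun x => f (G.weight x)

/-- Disjoint union. -/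
def disjointUnion {A : Type} (G : A → WeightedGradedGraph.{u, v} X) :
    WeightedGradedGraph.{u, v} X where
  Node := Σ a, (G a).Node
  graph := ⨆ a, (G a).graph.map (Sigma.mk a)
  grading := fun x => (G x.1).grading x.2
  weight := fun x => (G x.1).weight x.2

/-- The pairs of nodes to be identified: those related by `r` that lie in the same grading. -/
def Glue (G : WeightedGradedGraph.{u, v} X) (r : G.Node → G.Node → Prop) (x y : G.Node) : Prop :=
  G.grading x = G.grading y ∧ r x y

/-- Identify `x` and `y` whenever they are in the same grading and `r x y`; weights of identified
nodes are added up, and only one edge is kept between two nodes. -/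
def identify [AddCommMonoid X] (G : WeightedGradedGraph.{u, v} X) (r : G.Node → G.Node → Prop) :
    WeightedGradedGraph.{u, v} X where
  Node := Quot (G.Glue r)
  graph := G.graph.map (Quot.mk (G.Glue r))
  grading := Quot.lift G.grading (fun _ _ h => h.1)
  weight := fun c => ∑ᶠ x ∈ {x : G.Node | Quot.mk (G.Glue r) x = c}, G.weight x

end WeightedGradedGraph

/-- A graph with a bigrading and a weight in `X` at each node. -/
structure WeightedBigradedGraph (X : Type v) where
  Node : Type u
  graph : SimpleGraph Node
  bigrading : Node → ℚ × ℚ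
  weight : Node → X

namespace WeightedBigradedGraph

variable {X : Type v}

/-- Edges in the `V`-direction: the first grading is constant along them. -/
def VEdge (B : WeightedBigradedGraph.{u, v} X) (x y : B.Node) : Prop :=
  (B.bigrading x).1 = (B.bigrading y).1 ∧ B.graph.Adj x y

/-- Collapse of a weighted bigraded graph to its first grading: contract all edges in the
`V`-direction. The weight is read off at any node; it is used when the weights are constant in the
`V`-direction. -/
def collapseU (B : WeightedBigradedGraph.{u, v} X) : WeightedGradedGraph.{u, v} X where
  Node := Quot B.VEdge
  graph := B.graph.map (Quot.mk B.VEdge)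
  grading := Quot.lift (fun x => (B.bigrading x).1) (fun _ _ h => h.1)
  weight := fun c => B.weight c.out

end WeightedBigradedGraph

/-! ## Plumbing graphs -/

/-- A plumbing graph: an integer weighted forest. -/
structure PlumbingGraph (V : Type u) where
  graph : SimpleGraph V
  weight : V → ℤ
  isAcyclic : graph.IsAcyclic

/-- The rational vector of an integer vector. -/
def toQ {V : Type u} (K : V → ℤ) : V → ℚ := fun v => (K v : ℚ)

namespace PlumbingGraph

variable {V : Type u} [Fintype V] [DecidableEq V] {R : Type v} [CommRing R] (P : PlumbingGraph V)

open Classical in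
/-- The degree of a vertex. -/
def deg (v : V) : ℕ := P.graph.degree v

open Classical in
/-- The intersection matrix `M`: the weights on the diagonal, `1` for each edge. -/
def M : Matrix V V ℤ := Matrix.diagonal P.weight + P.graph.adjMatrix ℤ

/-- `M` as a rational matrix. -/
def MQ : Matrix V V ℚ := P.M.map (Int.cast : ℤ → ℚ)

/-- The plumbing graph is negative definite. -/
def IsNegDef : Prop := (-(P.M.map (Int.cast : ℤ → ℝ))).PosDef

/-- `x^2 = xᵀ M⁻¹ x`. -/
def sq (x : V → ℚ) : ℚ := x ⬝ᵥ (P.MQ⁻¹ *ᵥ x)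

theorem IsNegDef.det_ne_zero {P : PlumbingGraph V} (hP : P.IsNegDef) : P.M.det ≠ 0 := by
  intro h
  have h1 := hP.det_pos
  have h2 : (P.M.map (Int.cast : ℤ → ℝ)).det = 0 := by
    have := (Int.castRingHom ℝ).map_det P.M
    rw [h] at this
    simpa using this.symm
  rw [Matrix.det_neg, h2] at h1
  simp at h1

theorem IsNegDef.nonpos {P : PlumbingGraph V} (hP : P.IsNegDef) (x : V → ℚ) :
    x ⬝ᵥ (P.MQ *ᵥ x) ≤ 0 := by
  have h := hP.posSemidef.dotProduct_mulVec_nonneg (fun v => (x v : ℝ))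
  have e : ((x ⬝ᵥ (P.MQ *ᵥ x) : ℚ) : ℝ) =
      (fun v => (x v : ℝ)) ⬝ᵥ (P.M.map (Int.cast : ℤ → ℝ) *ᵥ (fun v => (x v : ℝ))) := by
    simp [dotProduct, mulVec, MQ]
  rw [Matrix.neg_mulVec, dotProduct_neg] at h
  have h' : (fun v => (x v : ℝ)) ⬝ᵥ (P.M.map (Int.cast : ℤ → ℝ) *ᵥ (fun v => (x v : ℝ))) ≤ 0 := by
    have : star (fun v => (x v : ℝ)) = (fun v => (x v : ℝ)) := by ext; simp
    rw [this] at h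
    linarith
  rw [← e] at h'
  exact_mod_cast h'

/-- Sanity check for the sums below: if the graph is negative definite, then only finitely many
lattice points have `K^2 ≥ c`; in particular superlevel sets are finite. -/
theorem IsNegDef.finite_sq_ge {P : PlumbingGraph V} (hP : P.IsNegDef) (c : ℚ) :
    {K : V → ℤ | c ≤ P.sq (toQ K)}.Finite := by
  have hdet : IsUnit P.MQ.det := by
    have : P.MQ.det = (P.M.det : ℚ) := ((Int.castRingHom ℚ).map_det P.M).symm
    rw [this]
    exact (Int.cast_ne_zero.mpr hP.det_ne_zero).isUnit
  have hsymm : P.MQᵀ = P.MQ := by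
    simp [MQ, M, ← Matrix.transpose_map, Matrix.transpose_add]
  have key : ∀ (K : V → ℤ) (i : V), ((K i : ℚ)) ^ 2 ≤ P.weight i * P.sq (toQ K) := by
    intro K i
    set x : V → ℚ := P.MQ⁻¹ *ᵥ toQ K with hx
    have hMx : P.MQ *ᵥ x = toQ K := by
      rw [hx, Matrix.mulVec_mulVec, Matrix.mul_nonsing_inv _ hdet, Matrix.one_mulVec]
    have hw : P.MQ i i = P.weight i := by simp [MQ, M]
    have hxx : x ⬝ᵥ (P.MQ *ᵥ x) = P.sq (toQ K) := by
      rw [hMx, dotProduct_comm, sq]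
    have hex : ∀ τ σ : ℚ, (σ • x - τ • Pi.single i 1) ⬝ᵥ (P.MQ *ᵥ (σ • x - τ • Pi.single i 1)) =
        σ ^ 2 * P.sq (toQ K) - 2 * σ * τ * K i + τ ^ 2 * P.weight i := by
      intro τ σ
      have h1 : (Pi.single i 1 : V → ℚ) ⬝ᵥ (P.MQ *ᵥ x) = K i := by
        rw [hMx]; simp [toQ]
      have h2 : x ⬝ᵥ (P.MQ *ᵥ (Pi.single i 1 : V → ℚ)) = K i := by
        rw [Matrix.dotProduct_mulVec, ← Matrix.mulVec_transpose, hsymm, dotProduct_comm, h1]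
      have h3 : (Pi.single i 1 : V → ℚ) ⬝ᵥ (P.MQ *ᵥ (Pi.single i 1 : V → ℚ)) = P.weight i := by
        simp [hw]
      simp only [Matrix.mulVec_sub, Matrix.mulVec_smul, sub_dotProduct, dotProduct_sub,
        smul_dotProduct, dotProduct_smul, smul_eq_mul, h1, h2, h3, hxx]
      ring
    have hneg : (P.weight i : ℚ) < 0 := by
      have h := hP.diag_pos (i := i)
      simp [M] at h
      exact_mod_cast h
    have := hP.nonpos ((P.weight i : ℚ) • x - (K i : ℚ) • Pi.single i 1)
    rw [hex] at this
    nlinarith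
  refine (Set.Finite.pi' (t := fun i => {n : ℤ | (n : ℚ) ^ 2 ≤ P.weight i * c}) ?_).subset ?_
  · intro i
    refine (Set.finite_Icc (-⌈(P.weight i * c : ℚ)⌉) ⌈(P.weight i * c : ℚ)⌉).subset ?_
    intro n hn
    have h1 : ((n ^ 2 : ℤ) : ℚ) ≤ (⌈(P.weight i * c : ℚ)⌉ : ℤ) := by
      push_cast
      exact le_trans hn (Int.le_ceil _)
    have h2 : n ^ 2 ≤ ⌈(P.weight i * c : ℚ)⌉ := by exact_mod_cast h1
    have h3 : |n| ≤ n ^ 2 := by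
      rw [← sq_abs]
      nlinarith [abs_nonneg n, sq_nonneg (|n|), mul_self_nonneg (|n| - 1), Int.le_self_sq |n|]
    exact abs_le.mp (h3.trans h2)
  · intro K hK i
    have hneg : (P.weight i : ℚ) < 0 := by
      have h := hP.diag_pos (i := i)
      simp [M] at h
      exact_mod_cast h
    have := key K i
    have h2 : (P.weight i : ℚ) * P.sq (toQ K) ≤ P.weight i * c :=
      mul_le_mul_of_nonpos_left hK hneg.le
    exact this.trans h2

/-- The vector `M u`, `u = (1, …, 1)`. -/
def Mu : V → ℤ := P.M *ᵥ 1

/-- Characteristic vectors, `m + 2 ℤ^s`. -/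
def Char : Set (V → ℤ) := {K | ∃ x : V → ℤ, K = P.weight + 2 • x}

/-- The class `[k] = k + 2 M ℤ^s`. -/
def cls (k : V → ℤ) : Set (V → ℤ) := {K | ∃ x : V → ℤ, K = k + 2 • (P.M *ᵥ x)}

/-- The set of spin^c structures `(m + 2 ℤ^s) / 2 M ℤ^s`, each one being viewed as the coset
`[k] ⊆ Char`. -/
def SpinC : Set (Set (V → ℤ)) := {s | ∃ k ∈ P.Char, s = P.cls k}

/-- `h_U(K) = (K^2 + s) / 4`. -/
def hU (K : V → ℤ) : ℚ := (P.sq (toQ K) + Fintype.card V) / 4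

/-- The graph on all lattice points with `K, K'` joined by an edge if `K - K' = ± 2 M e_i`. -/
def latticeGraph : SimpleGraph (V → ℤ) :=
  SimpleGraph.fromRel fun K K' => ∃ i : V, K' = K + 2 • (P.M *ᵥ Pi.single i 1)

/-- The connected components, as sets of lattice points, of the graph spanned by `S`. -/
def components (S : Set (V → ℤ)) : Set (Set (V → ℤ)) :=
  {C | ∃ c : (P.latticeGraph.induce S).ConnectedComponent, C = Subtype.val '' c.supp}

/-- The connected component of the graph spanned by `S` that contains `C`
(for `C ⊆ S` nonempty and connected there is exactly one). -/
def componentContaining (S C : Set (V → ℤ)) : Set (V → ℤ) := ⋃₀ {D ∈ P.components S | C ⊆ D}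

/-- The superlevel set of `h_U` in the spin^c structure `s`. -/
def superlevel (s : Set (V → ℤ)) (h : ℚ) : Set (V → ℤ) := {K ∈ s | h ≤ P.hU K}

/-- The gradings `2ℤ + h_U(k)`, where `k` represents `s`. -/
def gradings (s : Set (V → ℤ)) : Set ℚ := {h | ∃ k ∈ s, ∃ n : ℤ, h = 2 * n + P.hU k}

/-- The nodes of the graded root: pairs `(h, C)`, with `C` a component of the superlevel set at
`h`. -/
def rootNodes (s : Set (V → ℤ)) : Set (ℚ × Set (V → ℤ)) :=
  {η | η.1 ∈ P.gradings s ∧ η.2 ∈ P.components (P.superlevel s η.1)}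

/-- The (downward pointing) graded root of `s`, with weight `w C` at the component `C`. -/
def root {X : Type v} (s : Set (V → ℤ)) (w : Set (V → ℤ) → X) : WeightedGradedGraph.{u, v} X where
  Node := P.rootNodes s
  graph := SimpleGraph.fromRel fun η η' => η'.1.1 = η.1.1 - 2 ∧ η.1.2 ⊆ η'.1.2
  grading := fun η => η.1.1
  weight := fun η => w η.1.2

/-- `W_Γ(K) = ∏ W_{δ_i}((K - ε M u)_i)`. -/
def coeffW (W : ℕ → ℤ → R) (ε : ℤ) (K : V → ℤ) : R := ∏ v, W (P.deg v) (K v - ε * P.Mu v)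

/-- The contribution of the characteristic vector `K` to the weights. -/
def term (W : ℕ → ℤ → R) (ε : ℤ) (K : V → ℤ) : QT R :=
  QT.monomial
    (-((3 * Fintype.card V + (∑ v, (P.weight v : ℚ))) / 4) - P.sq (toQ (K - ε • P.Mu)) / 4)
    (-(ε * (∑ v, (P.Mu v : ℚ))) / 2 + (∑ v, (K v : ℚ)) / 2)
    (P.coeffW W ε K)

/-- The weight of a component: the sum over its lattice points. -/
def compWeight (W : ℕ → ℤ → R) (ε : ℤ) (C : Set (V → ℤ)) : QT R := fun e =>
  ∑ᶠ K ∈ C, P.term W ε K e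

/-- The weighted graded root `R_ε(Γ, s, W)`. -/
def weightedRoot (W : ℕ → ℤ → R) (ε : ℤ) (s : Set (V → ℤ)) : WeightedGradedGraph.{u, v} (QT R) :=
  P.root s (P.compWeight W ε)

/-- The two-variable `q`-series of the spin^c structure `s`, that is
`q^(-(3s+∑m_v)/4) ∮ ∏ dz_v/(2πi z_v) (t^(-1/2) z_v - t^(1/2) z_v⁻¹)^(2-δ_v)
  ∑_ℓ q^(-ℓ²/4) ∏ z_v^(ℓ_v)`,
where `ℓ` runs over the class `a + 2 M ℤ^s` with `[a + M u] = s`; the constant term of the summand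
of `ℓ` is `∏ W_{δ_v}(ℓ_v) t^(ℓ_v/2)`. The BPS `q`-series is the case `W = What`. -/
def Zhat (W : ℕ → ℤ → R) (s : Set (V → ℤ)) : QT R := fun e =>
  ∑ᶠ l ∈ {l : V → ℤ | l + P.Mu ∈ s},
    QT.monomial (-((3 * Fintype.card V + (∑ v, (P.weight v : ℚ))) / 4) - P.sq (toQ l) / 4)
      ((∑ v, (l v : ℚ)) / 2) (∏ v, W (P.deg v) (l v)) e

end PlumbingGraph

/-! ## Marked plumbing graphs -/

/-- The restriction `L|_Γ`. -/
def restrictΓ {ι : Type u} (L : Option ι → ℤ) : ι → ℤ := fun i => L (some i)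

/-- `σ(a) = -(a - p/2)² / p - 1/4`, where `p = Σ²`. -/
def sigmaShift (p a : ℚ) : ℚ := -(1 / p) * (a - p / 2) ^ 2 - 1 / 4

/-- A marked plumbing graph: a tree with vertices `ι ∪ {v₀}`, where the marked vertex `v₀ = none`
carries no weight. -/
structure MarkedPlumbingGraph (ι : Type u) where
  graph : SimpleGraph (Option ι)
  weight : ι → ℤ
  isTree : graph.IsTree

namespace MarkedPlumbingGraph

variable {ι : Type u} [Fintype ι] [DecidableEq ι] {R : Type v} [CommRing R]
  (Γ : MarkedPlumbingGraph ι)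

/-- The ambient plumbing graph: delete `v₀` and its edges. -/
def ambient : PlumbingGraph ι where
  graph := Γ.graph.comap some
  weight := Γ.weight
  isAcyclic := Γ.isTree.isAcyclic.comap (SimpleGraph.Embedding.comap Function.Embedding.some
    Γ.graph).toHom (Option.some_injective ι)

/-- The surgered plumbing graph: give `v₀` the weight `m₀`. -/
def surgered (m₀ : ℤ) : PlumbingGraph (Option ι) where
  graph := Γ.graph
  weight := fun v => v.elim m₀ Γ.weight
  isAcyclic := Γ.isTree.isAcyclic

open Classical in
/-- The degree of a vertex in the marked graph. -/
def deg (v : Option ι) : ℕ := Γ.graph.degree v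

open Classical in
/-- `λ_i = 1` if `v_i` is adjacent to `v₀`, and `0` otherwise. -/
def lam (i : ι) : ℤ := if Γ.graph.Adj (some i) none then 1 else 0

/-- The (rational) Seifert framing `λᵀ M⁻¹ λ`. -/
def sf : ℚ := Γ.ambient.sq (toQ Γ.lam)

/-- `Σ = (1, - M⁻¹ λ)`. -/
def Sig (v : Option ι) : ℚ := v.elim 1 (-(Γ.ambient.MQ⁻¹ *ᵥ toQ Γ.lam))

/-- `p = Σ² = Σᵀ M_{v₀,m₀} Σ`. -/
def p (m₀ : ℤ) : ℚ := Γ.Sig ⬝ᵥ ((Γ.surgered m₀).MQ *ᵥ Γ.Sig)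

/-- The Alexander grading `a(L) = (L(Σ) + Σ²) / 2`. -/
def alex (m₀ : ℤ) (L : Option ι → ℤ) : ℚ := (toQ L ⬝ᵥ Γ.Sig + Γ.p m₀) / 2

/-- The set `𝒜(t)` of Alexander gradings of a spin^c structure of the surgered graph. -/
def alexSet (m₀ : ℤ) (t : Set (Option ι → ℤ)) : Set ℚ := Γ.alex m₀ '' t

/-- The spin^c structure `t_a` of the ambient graph, represented by `L|_Γ` for any `L ∈ t` with
`a(L) = a`. -/
def spincAt (m₀ : ℤ) (t : Set (Option ι → ℤ)) (a : ℚ) : Set (ι → ℤ) :=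
  {K | ∃ L ∈ t, Γ.alex m₀ L = a ∧ K ∈ Γ.ambient.cls (restrictΓ L)}

/-- `h_V(K) = h_U(K + 2 λ)`. -/
def hV (K : ι → ℤ) : ℚ := Γ.ambient.hU (K + 2 • Γ.lam)

/-- `𝒮_{i,j}`. -/
def superlevelUV (s : Set (ι → ℤ)) (i j : ℚ) : Set (ι → ℤ) :=
  {K ∈ s | i ≤ Γ.ambient.hU K ∧ j ≤ Γ.hV K}

/-- `𝒮^V_j`. -/
def superlevelV (s : Set (ι → ℤ)) (j : ℚ) : Set (ι → ℤ) := {K ∈ s | j ≤ Γ.hV K}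

/-- The gradings `2ℤ + h_V(k)`, where `k` represents `s`. -/
def gradingsV (s : Set (ι → ℤ)) : Set ℚ := {h | ∃ k ∈ s, ∃ n : ℤ, h = 2 * n + Γ.hV k}

/-- `W_{Γ_{v₀}}(K) = ∏ W_{δ_i}((K - ε (M u + λ))_i)`; the degrees are those in the marked graph. -/
def coeffW (W : ℕ → ℤ → R) (ε : ℤ) (K : ι → ℤ) : R :=
  ∏ i, W (Γ.deg (some i)) (K i - ε * (Γ.ambient.Mu i + Γ.lam i))

/-- The exponent `ξ(K)` of `q`. -/
def xi (ε : ℤ) (K : ι → ℤ) : ℚ :=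
  -(3 * Fintype.card ι + (∑ v, (Γ.deg v : ℚ)) + 2 * (∑ i, (Γ.weight i : ℚ)) + 2 * Γ.sf) / 4
    - Γ.ambient.sq (toQ K) / 4 + ε * (toQ K ⬝ᵥ (Γ.ambient.MQ⁻¹ *ᵥ toQ Γ.lam)) / 2
    + ε * (∑ i, (K i : ℚ)) / 2

/-- The exponent `ζ(K)` of `z`. -/
def zeta (ε : ℤ) (K : ι → ℤ) : ℚ :=
  toQ Γ.lam ⬝ᵥ (Γ.ambient.MQ⁻¹ *ᵥ toQ K) - ε * Γ.sf - ε * Γ.deg none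

/-- The exponent `θ(K)` of `t`. -/
def theta (ε : ℤ) (K : ι → ℤ) : ℚ :=
  ((∑ i, (K i : ℚ)) - ε * (∑ i, ((Γ.deg (some i) : ℚ) + Γ.weight i))) / 2

/-- The contribution of `K` to the weights,
`(t^(-1/2) z - t^(1/2) z⁻¹)^(1-δ₀) W_{Γ_{v₀}}(K) q^ξ(K) z^ζ(K) t^θ(K)`; note that
`1 - δ₀ = 2 - (δ₀ + 1)`. -/
def term (W : ℕ → ℤ → R) (ε : ℤ) (K : ι → ℤ) : ZQT R := fun r =>
  Γ.coeffW W ε K •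
    QT.shift (Γ.xi ε K) (Γ.theta ε K) (expansion W (Γ.deg none + 1) (r - Γ.zeta ε K))

/-- The weight of a component: the sum over its lattice points. -/
def compWeight (W : ℕ → ℤ → R) (ε : ℤ) (C : Set (ι → ℤ)) : ZQT R := fun r e =>
  ∑ᶠ K ∈ C, Γ.term W ε K r e

/-- The weighted graded root `R_ε(Γ_{v₀}, s, W)` of the knot complement. -/
def weightedRoot (W : ℕ → ℤ → R) (ε : ℤ) (s : Set (ι → ℤ)) : WeightedGradedGraph.{u, v} (ZQT R) :=
  Γ.ambient.root s (Γ.compWeight W ε)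

/-- The nodes of the bigraded root: `((i, j), C)` with `C` a component of `𝒮_{i,j}`. -/
def bigradedNodes (s : Set (ι → ℤ)) : Set ((ℚ × ℚ) × Set (ι → ℤ)) :=
  {ν | ν.1.1 ∈ Γ.ambient.gradings s ∧ ν.1.2 ∈ Γ.gradingsV s ∧
    ν.2 ∈ Γ.ambient.components (Γ.superlevelUV s ν.1.1 ν.1.2)}

/-- The weighted bigraded root `R^bi_ε(Γ_{v₀}, s, W)`: the weight of `C` in bigrading `(i, j)` is
that of the component `C^U` of `𝒮^U_i` which contains `C`. -/
def weightedBigradedRoot (W : ℕ → ℤ → R) (ε : ℤ) (s : Set (ι → ℤ)) :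
    WeightedBigradedGraph.{u, v} (ZQT R) where
  Node := Γ.bigradedNodes s
  graph := SimpleGraph.fromRel fun ν ν' =>
    (ν'.1.1 = (ν.1.1.1 + 2, ν.1.1.2) ∨ ν'.1.1 = (ν.1.1.1, ν.1.1.2 + 2)) ∧ ν'.1.2 ⊆ ν.1.2
  bigrading := fun ν => ν.1.1
  weight := fun ν => Γ.compWeight W ε
    (Γ.ambient.componentContaining (Γ.ambient.superlevel s ν.1.1.1) ν.1.2)

/-- The coordinate `(η₁, η₂)` of a node `C` of the bigraded root in bigrading `(i, j)`: `η₁` is the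
node of the graded root of `s` given by the component `C^U` of `𝒮^U_i` containing `C`, and `η₂` is
the node of the graded root of `s + 2λ` given by the component `C^V` of `𝒮^V_j` containing `C`,
where `𝒮^V_j` is identified with the superlevel set of `h_U` in `s + 2λ` by `K ↦ K + 2λ`. -/
def coordinate (s : Set (ι → ℤ)) (ν : (ℚ × ℚ) × Set (ι → ℤ)) :
    (ℚ × Set (ι → ℤ)) × (ℚ × Set (ι → ℤ)) :=
  ((ν.1.1, Γ.ambient.componentContaining (Γ.ambient.superlevel s ν.1.1) ν.2),
    (ν.1.2, (fun K => K + 2 • Γ.lam) ''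
      Γ.ambient.componentContaining (Γ.superlevelV s ν.1.2) ν.2))

/-- The three-variable series of the knot complement for the label `[b] = b + 2 M ℤ^s`, with
`b ∈ δ|_Γ + 2 ℤ^s`:
`(t^(-1/2) z - t^(1/2) z⁻¹)^(1-δ₀) q^(-(3s+∑m_v+λᵀM⁻¹λ)/4)
  ∮ ∏_{v ≠ v₀} dz_v/(2πi z_v) (t^(-1/2) z_v - t^(1/2) z_v⁻¹)^(2-δ_v)
  ∑_{ℓ ∈ [b]} q^(-ℓ²/4) z^(λᵀM⁻¹ℓ) ∏ z_v^(ℓ_v)`.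
The BPS `q`-series is the case `W = What`. -/
def Zhat (W : ℕ → ℤ → R) (b : ι → ℤ) : ZQT R := fun r e =>
  ∑ᶠ l ∈ Γ.ambient.cls b,
    (∏ i, W (Γ.deg (some i)) (l i)) *
      QT.shift
        (-((3 * Fintype.card ι + (∑ i, (Γ.weight i : ℚ)) + Γ.sf) / 4) - Γ.ambient.sq (toQ l) / 4)
        ((∑ i, (l i : ℚ)) / 2)
        (expansion W (Γ.deg none + 1) (r - toQ Γ.lam ⬝ᵥ (Γ.ambient.MQ⁻¹ *ᵥ toQ l))) e

end MarkedPlumbingGraph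

/-! ## The surgery algorithm -/

/-- The disjoint union of the slices `L_p^{(a,ε)}[G_a]{-σ(a)}`, `a ∈ A`. -/
def surgerySlices {R : Type v} [CommRing R] (p : ℚ) (ε : ℤ) (A : Set ℚ)
    (G : A → WeightedGradedGraph.{u, v} (ZQT R)) : WeightedGradedGraph.{u, v} (QT R) :=
  WeightedGradedGraph.disjointUnion fun a : A =>
    ((G a).mapWeight (laplace p a ε)).shift (-sigmaShift p a)

/-- The identifications: `η₁` in the slice `a` and `η₂` in the slice `a + p` are related if
`coord a (a + p) η₁ η₂`. -/
def surgeryRel {R : Type v} [CommRing R] (p : ℚ) (ε : ℤ) (A : Set ℚ)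
    (G : A → WeightedGradedGraph.{u, v} (ZQT R))
    (coord : ∀ a b : A, (G a).Node → (G b).Node → Prop) (x y : (surgerySlices p ε A G).Node) :
    Prop :=
  (y.1 : ℚ) = x.1 + p ∧ coord x.1 y.1 x.2 y.2

/-- The output of the surgery algorithm, for weighted graded roots `G a` (`a ∈ A`) and a relation
`coord` telling which pairs of nodes are coordinates of nodes of the bigraded root. -/
def surgeryRoot {R : Type v} [CommRing R] (p : ℚ) (ε : ℤ) (A : Set ℚ)
    (G : A → WeightedGradedGraph.{u, v} (ZQT R))
    (coord : ∀ a b : A, (G a).Node → (G b).Node → Prop) : WeightedGradedGraph.{u, v} (QT R) :=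
  (surgerySlices p ε A G).identify (surgeryRel p ε A G coord)

namespace MarkedPlumbingGraph

variable {ι : Type u} [Fintype ι] [DecidableEq ι] {R : Type v} [CommRing R]
  (Γ : MarkedPlumbingGraph ι) (W : ℕ → ℤ → R) (ε : ℤ) (m₀ : ℤ) (t : Set (Option ι → ℤ))

/-- The weighted graded roots `R_ε(Γ_{v₀}, t_a, W)`, `a ∈ 𝒜(t)`. -/
def rootAt (a : Γ.alexSet m₀ t) : WeightedGradedGraph.{u, v} (ZQT R) :=
  Γ.weightedRoot W ε (Γ.spincAt m₀ t a)

/-- The weighted bigraded roots `R^bi_ε(Γ_{v₀}, t_a, W)`, `a ∈ 𝒜(t)`. -/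
def bigradedRootAt (a : Γ.alexSet m₀ t) : WeightedBigradedGraph.{u, v} (ZQT R) :=
  Γ.weightedBigradedRoot W ε (Γ.spincAt m₀ t a)

/-- `(η₁, η₂)` is the coordinate of a node of the bigraded root of `t_a`
(used when `b = a + p`). -/
def coordAt (a b : Γ.alexSet m₀ t) (η₁ : (Γ.rootAt W ε m₀ t a).Node)
    (η₂ : (Γ.rootAt W ε m₀ t b).Node) : Prop :=
  ∃ ν : (Γ.bigradedRootAt W ε m₀ t a).Node, Γ.coordinate (Γ.spincAt m₀ t a) ν.1 = (η₁.1, η₂.1)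

/-- Step 1 of the surgery algorithm: the disjoint union over `a ∈ 𝒜(t)` of
`L_p^{(a,ε)}[R_ε(Γ_{v₀}, t_a, W)]{-σ(a)}`. -/
def slices : WeightedGradedGraph.{u, v} (QT R) :=
  surgerySlices (Γ.p m₀) ε (Γ.alexSet m₀ t) (Γ.rootAt W ε m₀ t)

/-- The identifications made in step 2 of the surgery algorithm. -/
def glue : (Γ.slices W ε m₀ t).Node → (Γ.slices W ε m₀ t).Node → Prop :=
  surgeryRel (Γ.p m₀) ε (Γ.alexSet m₀ t) (Γ.rootAt W ε m₀ t) (Γ.coordAt W ε m₀ t)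

/-- The output of the surgery algorithm. -/
def algorithmRoot : WeightedGradedGraph.{u, v} (QT R) :=
  surgeryRoot (Γ.p m₀) ε (Γ.alexSet m₀ t) (Γ.rootAt W ε m₀ t) (Γ.coordAt W ε m₀ t)

end MarkedPlumbingGraph

end

set_option linter.unusedSectionVars false

noncomputable section

/-! ## Linear algebra of plumbing graphs -/

section toQ

variable {V : Type u}

/-! The vector Σ is orthogonal to all vertices except `v₀`: applying the matrix of the surgered
graph to it gives p e₀ (`surgered_MQ_mulVec_Sig`). So a characteristic vector L is determined by the
pair (a(L), L|_Γ), its square splits as (L|_Γ)² + (L·Σ)²/p, and h_U(L) = h_U(L|_Γ) - σ(a(L))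
(`eq_of_alex_eq`, `surgered_sq`, `hU_surgered`). Thus the superlevel set of 𝔱 at h is the disjoint
union over a of the superlevel sets of 𝔱_a at h + σ(a).

A move by 2Me_i at a vertex of Γ stays in its slice and restricts to the same move in Γ; a move at
`v₀` goes from slice a to slice a + p and sends K to K + 2λ. Components upstairs are therefore
components of the slices, joined whenever some K in slice a has h_U(K) ≥ i and h_V(K) ≥ j, where i
and j are the gradings in the two slices. Such a K is a point of the bigraded root, and the
coordinate of its node is the pair being joined (`rootNode_eq_of_glue`, `mk_sliceNode_add_single`).

For the weights, the Laplace transform sends the summand of L|_Γ to that of L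
(`laplace_latticeTerm`): the z-constant term picks two values of W_{δ₀+1}, whose difference is
W_{δ₀}, the missing factor at `v₀`, while the power of q supplies (L - εMu)·Σ squared over p.
Summing over the fibres of identified slice nodes, which partition a component, gives its weight
(`algorithmRoot_weight`).

The collapse statement holds because superlevel sets of h_U are finite: for j small enough the
condition on h_V is empty (`BigradedPoint.mk_eq`). The formula for the series is the same termwise
computation over all lattice points; unimodularity makes every slice of the index set the full class
of b (`bijOn_restrict`). -/

theorem toQ_add (x y : V → ℤ) : toQ (x + y) = toQ x + toQ y := by ext; simp [toQ]

theorem toQ_sub (x y : V → ℤ) : toQ (x - y) = toQ x - toQ y := by ext; simp [toQ]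

theorem toQ_zsmul (n : ℤ) (x : V → ℤ) : toQ (n • x) = (n : ℚ) • toQ x := by ext; simp [toQ]

theorem toQ_two_nsmul (x : V → ℤ) : toQ (2 • x) = (2 : ℚ) • toQ x := by ext; simp [toQ]

theorem toQ_dotProduct [Fintype V] (x y : V → ℤ) : toQ x ⬝ᵥ toQ y = ((x ⬝ᵥ y : ℤ) : ℚ) := by
  simp [toQ, dotProduct]

theorem toQ_mulVec [Fintype V] (A : Matrix V V ℤ) (x : V → ℤ) :
    toQ (A *ᵥ x) = A.map (Int.cast : ℤ → ℚ) *ᵥ toQ x := by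
  ext; simp [toQ, mulVec, dotProduct]

end toQ

namespace PlumbingGraph

variable {V : Type u} [Fintype V] [DecidableEq V] (P : PlumbingGraph V)

theorem M_transpose : P.Mᵀ = P.M := by simp [M, Matrix.transpose_add]

theorem MQ_transpose : P.MQᵀ = P.MQ := by rw [MQ, ← Matrix.transpose_map, M_transpose]

theorem MQ_inv_transpose : P.MQ⁻¹ᵀ = P.MQ⁻¹ := by
  rw [Matrix.transpose_nonsing_inv, MQ_transpose]

theorem dotProduct_MQ_inv_comm (x y : V → ℚ) :
    x ⬝ᵥ (P.MQ⁻¹ *ᵥ y) = y ⬝ᵥ (P.MQ⁻¹ *ᵥ x) := by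
  rw [Matrix.dotProduct_mulVec, ← Matrix.mulVec_transpose, MQ_inv_transpose, dotProduct_comm]

theorem dotProduct_MQ_comm (x y : V → ℚ) :
    x ⬝ᵥ (P.MQ *ᵥ y) = y ⬝ᵥ (P.MQ *ᵥ x) := by
  rw [Matrix.dotProduct_mulVec, ← Matrix.mulVec_transpose, MQ_transpose, dotProduct_comm]

variable {P} in
theorem IsNegDef.isUnit_det (hP : P.IsNegDef) : IsUnit P.MQ.det := by
  have : P.MQ.det = (P.M.det : ℚ) := ((Int.castRingHom ℚ).map_det P.M).symm
  rw [this]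
  exact (Int.cast_ne_zero.mpr hP.det_ne_zero).isUnit

variable {P} in
theorem IsNegDef.inv_mulVec_mulVec (hP : P.IsNegDef) (x : V → ℚ) :
    P.MQ⁻¹ *ᵥ (P.MQ *ᵥ x) = x := by
  rw [Matrix.mulVec_mulVec, Matrix.nonsing_inv_mul _ hP.isUnit_det, Matrix.one_mulVec]

variable {P} in
theorem IsNegDef.mulVec_inv_mulVec (hP : P.IsNegDef) (x : V → ℚ) :
    P.MQ *ᵥ (P.MQ⁻¹ *ᵥ x) = x := by
  rw [Matrix.mulVec_mulVec, Matrix.mul_nonsing_inv _ hP.isUnit_det, Matrix.one_mulVec]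

theorem sq_sub_smul (x y : V → ℚ) (c : ℚ) :
    P.sq (x - c • y) = P.sq x - 2 * c * (x ⬝ᵥ (P.MQ⁻¹ *ᵥ y)) + c ^ 2 * P.sq y := by
  simp only [sq, Matrix.mulVec_sub, Matrix.mulVec_smul, sub_dotProduct, dotProduct_sub,
    smul_dotProduct, dotProduct_smul, smul_eq_mul, P.dotProduct_MQ_inv_comm y x]
  ring

theorem sq_add (x y : V → ℚ) :
    P.sq (x + y) = P.sq x + 2 * (x ⬝ᵥ (P.MQ⁻¹ *ᵥ y)) + P.sq y := by
  have := P.sq_sub_smul x y (-1)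
  rw [neg_one_smul, sub_neg_eq_add] at this
  rw [this]; ring

variable {P} in
theorem IsNegDef.sq_mulVec (hP : P.IsNegDef) (x : V → ℚ) :
    P.sq (P.MQ *ᵥ x) = x ⬝ᵥ (P.MQ *ᵥ x) := by
  rw [sq, hP.inv_mulVec_mulVec, dotProduct_comm]

theorem M_apply_self (v : V) : P.M v v = P.weight v := by simp [M]

open Classical in
theorem M_apply_of_ne {v w : V} (h : v ≠ w) : P.M v w = if P.graph.Adj v w then 1 else 0 := by
  simp [M, h, SimpleGraph.adjMatrix_apply]

theorem Mu_apply (v : V) : P.Mu v = P.weight v + P.deg v := by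
  classical
  simp only [Mu, M, Matrix.add_mulVec, Pi.add_apply, deg]
  congr 1
  · simp [Matrix.mulVec_diagonal]
  · rw [SimpleGraph.adjMatrix_mulVec_apply]
    simp

/-- `xᵀ M x + mᵀ x` is even. -/
theorem even_dotProduct_mulVec_add (x : V → ℤ) :
    Even (x ⬝ᵥ (P.M *ᵥ x) + P.weight ⬝ᵥ x) := by
  classical
  have hd : x ⬝ᵥ (Matrix.diagonal P.weight *ᵥ x) + P.weight ⬝ᵥ x =
      ∑ v, P.weight v * (x v * (x v + 1)) := by
    simp only [dotProduct, Matrix.mulVec_diagonal, ← Finset.sum_add_distrib]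
    exact Finset.sum_congr rfl fun v _ => by ring
  -- Off the diagonal every edge contributes twice; modulo 2 the two contributions cancel under
  -- swapping its ends.
  have hA : Even (x ⬝ᵥ (P.graph.adjMatrix ℤ *ᵥ x)) := by
    have : x ⬝ᵥ (P.graph.adjMatrix ℤ *ᵥ x) =
        ∑ e : V × V, if P.graph.Adj e.1 e.2 then x e.1 * x e.2 else 0 := by
      simp only [dotProduct, mulVec, SimpleGraph.adjMatrix_apply, Finset.mul_sum,
        Fintype.sum_prod_type]
      refine Finset.sum_congr rfl fun v _ => Finset.sum_congr rfl fun w _ => ?_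
      split_ifs <;> simp
    rw [this, even_iff_two_dvd]
    refine (ZMod.intCast_zmod_eq_zero_iff_dvd _ 2).mp ?_
    rw [Int.cast_sum]
    refine Finset.sum_involution (fun e _ => e.swap) ?_ ?_ (by simp) (by simp)
    · intro e _
      simp only [Prod.fst_swap, Prod.snd_swap, P.graph.adj_comm e.2 e.1, mul_comm (x e.2)]
      exact CharTwo.add_self_eq_zero _
    · rintro ⟨v, w⟩ _ h e
      simp only [Prod.swap_prod_mk, Prod.mk.injEq] at e
      simp [e.1] at h
  rw [M, Matrix.add_mulVec, dotProduct_add, add_right_comm, hd]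
  refine Even.add ?_ hA
  exact Finset.even_sum _ fun v _ => (Int.even_mul_succ_self _).mul_left _

variable {P} in
-- The inverse in the cross term cancels against M, leaving an integer. For characteristic k that
-- integer is even, which makes h_U constant modulo 2 on a class.
theorem IsNegDef.sq_add_two_mulVec (hP : P.IsNegDef) (k x : V → ℤ) :
    P.sq (toQ (k + 2 • (P.M *ᵥ x))) =
      P.sq (toQ k) + 4 * ((k ⬝ᵥ x + x ⬝ᵥ (P.M *ᵥ x) : ℤ) : ℚ) := by
  rw [toQ_add, toQ_two_nsmul, toQ_mulVec, sq_add, ← Matrix.mulVec_smul]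
  change _ + 2 * (_ ⬝ᵥ (P.MQ⁻¹ *ᵥ (P.MQ *ᵥ _))) + P.sq (P.MQ *ᵥ _) = _
  rw [hP.inv_mulVec_mulVec, hP.sq_mulVec]
  have : toQ x ⬝ᵥ (P.MQ *ᵥ toQ x) = ((x ⬝ᵥ (P.M *ᵥ x) : ℤ) : ℚ) := by
    rw [← toQ_dotProduct, toQ_mulVec]; rfl
  simp only [Matrix.mulVec_smul, smul_dotProduct, dotProduct_smul, smul_eq_mul, this,
    toQ_dotProduct]
  push_cast
  ring

variable {P} in
/-- `h_U` is constant modulo `2` on each spin^c structure. -/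
theorem IsNegDef.hU_sub_mem (hP : P.IsNegDef) {s : Set (V → ℤ)} (hs : s ∈ P.SpinC)
    {K K' : V → ℤ} (hK : K ∈ s) (hK' : K' ∈ s) : ∃ n : ℤ, P.hU K' = 2 * n + P.hU K := by
  obtain ⟨k, ⟨y, rfl⟩, rfl⟩ := hs
  have key : ∀ x : V → ℤ, ∃ n : ℤ, P.hU (P.weight + 2 • y + 2 • (P.M *ᵥ x)) =
      2 * n + P.hU (P.weight + 2 • y) := by
    intro x
    obtain ⟨n, hn⟩ := P.even_dotProduct_mulVec_add x
    -- Here xᵀMx + mᵀx = 2n, and the part 2y of the characteristic vector adds 2(y·x).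
    refine ⟨n + y ⬝ᵥ x, ?_⟩
    rw [hU, hP.sq_add_two_mulVec, hU, add_dotProduct, smul_dotProduct]
    have : P.weight ⬝ᵥ x + 2 • (y ⬝ᵥ x) + x ⬝ᵥ (P.M *ᵥ x) = 2 * (n + y ⬝ᵥ x) := by
      rw [nsmul_eq_mul]; push_cast; linarith
    rw [this]
    push_cast
    ring
  obtain ⟨x, rfl⟩ := hK
  obtain ⟨x', rfl⟩ := hK'
  obtain ⟨n, hn⟩ := key x
  obtain ⟨n', hn'⟩ := key x'
  exact ⟨n' - n, by rw [hn, hn']; push_cast; ring⟩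

end PlumbingGraph

/-! ## Linear algebra of marked plumbing graphs -/

namespace MarkedPlumbingGraph

variable {ι : Type u} [Fintype ι] [DecidableEq ι] (Γ : MarkedPlumbingGraph ι) (m₀ : ℤ)

theorem surgered_M_some_some (i j : ι) :
    (Γ.surgered m₀).M (some i) (some j) = Γ.ambient.M i j := by
  classical
  by_cases h : i = j
  · subst h
    simp only [PlumbingGraph.M_apply_self]
    rfl
  · rw [PlumbingGraph.M_apply_of_ne _ h, PlumbingGraph.M_apply_of_ne _ (by simpa using h)]
    rfl

theorem surgered_M_some_none (i : ι) : (Γ.surgered m₀).M (some i) none = Γ.lam i := by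
  classical
  rw [PlumbingGraph.M_apply_of_ne _ (by simp)]
  rfl

theorem surgered_M_none_some (i : ι) : (Γ.surgered m₀).M none (some i) = Γ.lam i := by
  rw [← surgered_M_some_none Γ m₀ i, ← Matrix.transpose_apply (Γ.surgered m₀).M,
    PlumbingGraph.M_transpose]

theorem surgered_M_none_none : (Γ.surgered m₀).M none none = m₀ := by
  rw [PlumbingGraph.M_apply_self]
  rfl

variable {Γ m₀} in
theorem ambient_isNegDef (h : (Γ.surgered m₀).IsNegDef) : Γ.ambient.IsNegDef := by
  have := h.submatrix (Option.some_injective ι)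
  have e : (-((Γ.surgered m₀).M.map (Int.cast : ℤ → ℝ))).submatrix some some =
      -(Γ.ambient.M.map (Int.cast : ℤ → ℝ)) := by
    ext i j
    simp [surgered_M_some_some]
  rwa [e] at this

theorem surgered_M_mulVec_some (x : Option ι → ℤ) (i : ι) :
    ((Γ.surgered m₀).M *ᵥ x) (some i) =
      x none * Γ.lam i + (Γ.ambient.M *ᵥ restrictΓ x) i := by
  simp [mulVec, dotProduct, Fintype.sum_option, surgered_M_some_some, surgered_M_some_none,
    restrictΓ, mul_comm]

theorem surgered_MQ_mulVec_some (x : Option ι → ℚ) (i : ι) :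
    ((Γ.surgered m₀).MQ *ᵥ x) (some i) =
      x none * toQ Γ.lam i + (Γ.ambient.MQ *ᵥ fun j => x (some j)) i := by
  simp [mulVec, dotProduct, Fintype.sum_option, surgered_M_some_some, surgered_M_some_none,
    PlumbingGraph.MQ, toQ, mul_comm]

theorem surgered_MQ_mulVec_none (x : Option ι → ℚ) :
    ((Γ.surgered m₀).MQ *ᵥ x) none = m₀ * x none + toQ Γ.lam ⬝ᵥ fun j => x (some j) := by
  simp [mulVec, dotProduct, Fintype.sum_option, surgered_M_none_some, surgered_M_none_none,
    PlumbingGraph.MQ, toQ]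

theorem surgered_Mu_some (i : ι) :
    (Γ.surgered m₀).Mu (some i) = Γ.ambient.Mu i + Γ.lam i := by
  have := Γ.surgered_M_mulVec_some m₀ 1 i
  have h1 : restrictΓ (1 : Option ι → ℤ) = 1 := rfl
  rw [PlumbingGraph.Mu, this, add_comm, h1, Pi.one_apply, one_mul, PlumbingGraph.Mu]

theorem surgered_deg (v : Option ι) : (Γ.surgered m₀).deg v = Γ.deg v := rfl

theorem surgered_Mu_none : (Γ.surgered m₀).Mu none = m₀ + Γ.deg none :=
  PlumbingGraph.Mu_apply _ _

/-- The entries of `Mu` off `v₀` do not involve m₀, so the weight 0 at `v₀` serves for the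
computation. The vector λ accounts for the edges to `v₀` which Γ has lost. -/
theorem ambient_Mu_add_lam (i : ι) :
    Γ.ambient.Mu i + Γ.lam i = Γ.weight i + Γ.deg (some i) := by
  rw [← surgered_Mu_some Γ 0 i, PlumbingGraph.Mu_apply]
  rfl

theorem sum_lam : ∑ i, Γ.lam i = Γ.deg none := by
  have h : (Γ.surgered 0).Mu none = ∑ i, Γ.lam i := by
    simp [PlumbingGraph.Mu, mulVec, dotProduct, Fintype.sum_option, surgered_M_none_some,
      surgered_M_none_none]
  rw [← h, surgered_Mu_none, zero_add]

theorem dotProduct_Sig (x : Option ι → ℚ) :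
    x ⬝ᵥ Γ.Sig = x none - (fun i => x (some i)) ⬝ᵥ (Γ.ambient.MQ⁻¹ *ᵥ toQ Γ.lam) := by
  simp [dotProduct, Sig, Fintype.sum_option, sub_eq_add_neg]

section NegDef

variable {Γ m₀} (h : (Γ.surgered m₀).IsNegDef)
include h

/-- Row i of the product is λ_i - (M M⁻¹λ)_i = 0: this is the orthogonality for which Σ is designed.
-/
theorem surgered_MQ_mulVec_Sig :
    (Γ.surgered m₀).MQ *ᵥ Γ.Sig = Pi.single none (m₀ - Γ.sf) := by
  have hS : (fun j => Γ.Sig (some j)) = -(Γ.ambient.MQ⁻¹ *ᵥ toQ Γ.lam) := rfl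
  ext v
  cases v with
  | none => rw [surgered_MQ_mulVec_none, hS]; simp [Sig, sf, PlumbingGraph.sq, sub_eq_add_neg]
  | some i =>
    rw [surgered_MQ_mulVec_some, hS, Matrix.mulVec_neg,
      (ambient_isNegDef h).mulVec_inv_mulVec]
    simp [Sig]

theorem p_eq : Γ.p m₀ = m₀ - Γ.sf := by
  rw [p, surgered_MQ_mulVec_Sig h]
  simp [Sig]

/-- If p vanished, Σ would lie in the kernel of a nondegenerate form, yet its entry at `v₀` is 1. -/
theorem p_ne_zero : Γ.p m₀ ≠ 0 := by
  intro hp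
  have h1 := surgered_MQ_mulVec_Sig h
  rw [← p_eq h, hp, Pi.single_zero] at h1
  have h2 := h.inv_mulVec_mulVec Γ.Sig
  rw [h1, Matrix.mulVec_zero] at h2
  simpa [Sig] using congrFun h2 none

/-- The quadratic form of the surgered graph splits along `Σ`. -/
theorem surgered_sq (x : Option ι → ℚ) :
    (Γ.surgered m₀).sq x =
      Γ.ambient.sq (fun i => x (some i)) + (x ⬝ᵥ Γ.Sig) ^ 2 / Γ.p m₀ := by
  have hp := p_ne_zero h
  -- The preimage of x under the surgered matrix is written down explicitly: invert M on Γ, extend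
  -- by 0 at `v₀`, and correct the entry at `v₀` by a multiple of Σ, which affects no other row.
  set z : Option ι → ℚ := fun v => v.elim 0 (Γ.ambient.MQ⁻¹ *ᵥ fun i => x (some i)) with hz
  have hzs : (fun j => z (some j)) = Γ.ambient.MQ⁻¹ *ᵥ fun i => x (some i) := rfl
  have hz0 : z none = 0 := rfl
  have hx : (Γ.surgered m₀).MQ *ᵥ (z + (x ⬝ᵥ Γ.Sig / Γ.p m₀) • Γ.Sig) = x := by
    rw [Matrix.mulVec_add, Matrix.mulVec_smul, surgered_MQ_mulVec_Sig h, ← p_eq h]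
    ext v
    cases v with
    | none =>
      simp only [Pi.add_apply, Pi.smul_apply, Pi.single_eq_same, smul_eq_mul]
      rw [div_mul_cancel₀ _ hp, surgered_MQ_mulVec_none, hzs, hz0, dotProduct_Sig,
        PlumbingGraph.dotProduct_MQ_inv_comm]
      ring
    | some i =>
      simp only [Pi.add_apply, Pi.smul_apply, smul_eq_mul]
      rw [surgered_MQ_mulVec_some, hzs, hz0, (ambient_isNegDef h).mulVec_inv_mulVec]
      simp
  have hinv : (Γ.surgered m₀).MQ⁻¹ *ᵥ x = z + (x ⬝ᵥ Γ.Sig / Γ.p m₀) • Γ.Sig := by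
    conv_lhs => rw [← hx]
    rw [h.inv_mulVec_mulVec]
  have hxz : x ⬝ᵥ z = Γ.ambient.sq (fun i => x (some i)) := by
    simp [dotProduct, Fintype.sum_option, hz, PlumbingGraph.sq]
  rw [PlumbingGraph.sq, hinv, dotProduct_add, dotProduct_smul, hxz, smul_eq_mul]
  ring

/-- Since L·Σ = 2a - p, a quarter of (L·Σ)²/p is (a - p/2)²/p; the 1/4 in σ counts the additional
vertex. -/
theorem hU_surgered (L : Option ι → ℤ) :
    (Γ.surgered m₀).hU L =
      Γ.ambient.hU (restrictΓ L) - sigmaShift (Γ.p m₀) (Γ.alex m₀ L) := by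
  have hp := p_ne_zero h
  have e : toQ (restrictΓ L) = fun i => toQ L (some i) := rfl
  rw [PlumbingGraph.hU, PlumbingGraph.hU, surgered_sq h, e, sigmaShift, alex, Fintype.card_option]
  push_cast
  field_simp
  ring

theorem mulVec_dotProduct_Sig (x : Option ι → ℚ) :
    ((Γ.surgered m₀).MQ *ᵥ x) ⬝ᵥ Γ.Sig = Γ.p m₀ * x none := by
  rw [dotProduct_comm, PlumbingGraph.dotProduct_MQ_comm, surgered_MQ_mulVec_Sig h, p_eq h]
  simp [mul_comm]

theorem alex_add_two_mulVec (L x : Option ι → ℤ) :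
    Γ.alex m₀ (L + 2 • ((Γ.surgered m₀).M *ᵥ x)) = Γ.alex m₀ L + Γ.p m₀ * x none := by
  rw [alex, toQ_add, toQ_two_nsmul, toQ_mulVec, add_dotProduct, smul_dotProduct]
  have := mulVec_dotProduct_Sig h (toQ x)
  rw [PlumbingGraph.MQ] at this
  rw [this, alex, smul_eq_mul, toQ]
  ring

theorem restrict_add_two_mulVec (L x : Option ι → ℤ) :
    restrictΓ (L + 2 • ((Γ.surgered m₀).M *ᵥ x)) =
      restrictΓ L + 2 • (Γ.ambient.M *ᵥ restrictΓ x) + (2 * x none) • Γ.lam := by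
  ext i
  simp only [restrictΓ, Pi.add_apply, Pi.smul_apply, surgered_M_mulVec_some, smul_eq_mul]
  simp only [nsmul_eq_mul]
  push_cast
  ring

end NegDef

/-- Σ has coefficient 1 at `v₀`, so the Alexander grading recovers the entry at `v₀` from the
restriction. -/
theorem eq_of_alex_eq {L L' : Option ι → ℤ} (ha : Γ.alex m₀ L = Γ.alex m₀ L')
    (hr : restrictΓ L = restrictΓ L') : L = L' := by
  have hs : ∀ i, L (some i) = L' (some i) := fun i => congrFun hr i
  ext v
  cases v with
  | some i => exact hs i
  | none =>
    have : (fun i => toQ L (some i)) = fun i => toQ L' (some i) := by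
      ext i; simp [toQ, hs i]
    rw [alex, alex, dotProduct_Sig, dotProduct_Sig, this] at ha
    have : toQ L none = toQ L' none := by linarith
    simpa [toQ] using this

end MarkedPlumbingGraph

/-! ## Monomials and the Laplace transform of a single summand -/

section Monomials

variable {R : Type v} [CommRing R]

theorem QT.shift_monomial (x y x' y' : ℚ) (c : R) :
    QT.shift x y (QT.monomial x' y' c) = QT.monomial (x + x') (y + y') c := by
  ext e
  simp only [QT.shift, QT.monomial, Pi.single_apply, Prod.ext_iff]
  congr 1
  simp only [sub_eq_iff_eq_add, add_comm]

theorem QT.smul_monomial (x y : ℚ) (c d : R) :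
    c • QT.monomial x y d = QT.monomial x y (c * d) := by
  rw [QT.monomial, ← Pi.single_smul, smul_eq_mul]; rfl

theorem QT.monomial_sub (x y : ℚ) (c d : R) :
    QT.monomial x y (c - d) = QT.monomial x y c - QT.monomial x y d :=
  Pi.single_sub _ _ _

theorem QT.monomial_apply_of_ne {x y : ℚ} (c : R) {e : ℚ × ℚ} (h : x ≠ e.1) :
    QT.monomial x y c e = 0 :=
  Pi.single_eq_of_ne (fun h' => h (by rw [h'])) _

theorem expansion_intCast (W : ℕ → ℤ → R) (n : ℕ) (k : ℤ) :
    expansion W n k = QT.monomial 0 (-k / 2) (W n (-k)) := by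
  simp [expansion]

/-- Each value of an expansion is a single power of `t`. -/
theorem expansion_apply_of_ne (W : ℕ → ℤ → R) (n : ℕ) (r : ℚ) {e : ℚ × ℚ} (h : e.1 ≠ 0) :
    expansion W n r e = 0 := by
  unfold expansion
  split_ifs
  · exact QT.monomial_apply_of_ne _ h.symm
  · rfl

end Monomials

namespace PlumbingGraph

variable {V : Type u} [Fintype V] [DecidableEq V] {R : Type v} [CommRing R] (P : PlumbingGraph V)

/-- The contribution of the lattice point `l` to the `q`-series of the plumbing graph. -/
def latticeTerm (W : ℕ → ℤ → R) (l : V → ℤ) : QT R :=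
  QT.monomial (-((3 * Fintype.card V + (∑ v, (P.weight v : ℚ))) / 4) - P.sq (toQ l) / 4)
    ((∑ v, (l v : ℚ)) / 2) (∏ v, W (P.deg v) (l v))

/-- The substitution ℓ = L - εMu turns summands of weights into summands of series, so one Laplace
computation serves both. -/
theorem term_eq_latticeTerm (W : ℕ → ℤ → R) (ε : ℤ) (K : V → ℤ) :
    P.term W ε K = P.latticeTerm W (K - ε • P.Mu) := by
  rw [term, latticeTerm]
  congr 1
  simp only [Pi.sub_apply, Pi.smul_apply, smul_eq_mul, Int.cast_sub, Int.cast_mul,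
    Finset.sum_sub_distrib, Finset.mul_sum]
  ring

/-- The power of q fixes ℓ², so a given coefficient only sees ℓ with ℓ² bounded below. Negative
definiteness then leaves finitely many. -/
theorem latticeTerm_apply_of_ne (W : ℕ → ℤ → R) (l : V → ℤ) {e : ℚ × ℚ}
    (h : P.sq (toQ l) < -(4 * e.1 + (3 * Fintype.card V + (∑ v, (P.weight v : ℚ))))) :
    P.latticeTerm W l e = 0 :=
  QT.monomial_apply_of_ne _ (by intro h'; linarith)

end PlumbingGraph

namespace MarkedPlumbingGraph

variable {ι : Type u} [Fintype ι] [DecidableEq ι] {R : Type v} [CommRing R]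
  (Γ : MarkedPlumbingGraph ι) {m₀ : ℤ}

/-- The contribution of the lattice point `l` to the three-variable series of the complement. -/
def latticeTerm (W : ℕ → ℤ → R) (l : ι → ℤ) : ZQT R := fun r =>
  (∏ i, W (Γ.deg (some i)) (l i)) •
    QT.shift
      (-((3 * Fintype.card ι + (∑ i, (Γ.weight i : ℚ)) + Γ.sf) / 4) - Γ.ambient.sq (toQ l) / 4)
      ((∑ i, (l i : ℚ)) / 2)
      (expansion W (Γ.deg none + 1) (r - toQ Γ.lam ⬝ᵥ (Γ.ambient.MQ⁻¹ *ᵥ toQ l)))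

theorem latticeTerm_apply_of_ne (W : ℕ → ℤ → R) (l : ι → ℤ) (r : ℚ) {e : ℚ × ℚ}
    (h : Γ.ambient.sq (toQ l) <
      -(4 * e.1 + (3 * Fintype.card ι + (∑ i, (Γ.weight i : ℚ)) + Γ.sf))) :
    Γ.latticeTerm W l r e = 0 := by
  rw [latticeTerm, Pi.smul_apply, QT.shift, expansion_apply_of_ne, smul_zero]
  intro h'
  simp only at h'
  linarith

variable {Γ} in
-- The exponents ξ, ζ, θ come from expanding at ℓ = K - ε(Mu + λ), using M⁻¹(Mu + λ) = u + M⁻¹λ and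
-- ε² = 1.
theorem term_eq_latticeTerm (hΓ : Γ.ambient.IsNegDef) (W : ℕ → ℤ → R) {ε : ℤ}
    (hε : ε = 1 ∨ ε = -1) (K : ι → ℤ) :
    Γ.term W ε K = Γ.latticeTerm W (K - ε • (Γ.ambient.Mu + Γ.lam)) := by
  set u : ι → ℚ := fun _ => 1 with hu
  have hε2 : (ε : ℚ) ^ 2 = 1 := by rcases hε with rfl | rfl <;> norm_num
  have hMu : toQ (Γ.ambient.Mu) = Γ.ambient.MQ *ᵥ u := by
    rw [PlumbingGraph.Mu, toQ_mulVec]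
    congr 1
  have hdot : ∀ x : ι → ℚ, x ⬝ᵥ u = ∑ i, x i := fun x => by simp [dotProduct, hu]
  have hlam : ∑ i, (Γ.lam i : ℚ) = Γ.deg none := by exact_mod_cast Γ.sum_lam
  have hsum : ∑ i, ((Γ.ambient.Mu i : ℚ) + Γ.lam i) =
      ∑ i, ((Γ.deg (some i) : ℚ) + Γ.weight i) :=
    Finset.sum_congr rfl fun i _ => by
      rw [add_comm (Γ.deg (some i) : ℚ)]; exact_mod_cast Γ.ambient_Mu_add_lam i
  have hinv : Γ.ambient.MQ⁻¹ *ᵥ toQ (Γ.ambient.Mu + Γ.lam) =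
      u + Γ.ambient.MQ⁻¹ *ᵥ toQ Γ.lam := by
    rw [toQ_add, Matrix.mulVec_add, hMu, hΓ.inv_mulVec_mulVec]
  have hdl : toQ Γ.lam ⬝ᵥ (Γ.ambient.MQ⁻¹ *ᵥ toQ (Γ.ambient.Mu + Γ.lam)) =
      Γ.deg none + Γ.sf := by
    rw [hinv, dotProduct_add, hdot, sf, PlumbingGraph.sq, ← hlam]
    rfl
  -- The pairing with u gives the weights and degrees over Γ; the pairing of `Mu` with M⁻¹λ is Σ λ_i
  -- = δ₀, which completes the sum of degrees; λ with itself gives `sf`.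
  have hsq : Γ.ambient.sq (toQ (Γ.ambient.Mu + Γ.lam)) =
      ∑ v, (Γ.deg v : ℚ) + ∑ i, (Γ.weight i : ℚ) + Γ.sf := by
    have h1 : toQ Γ.ambient.Mu ⬝ᵥ (Γ.ambient.MQ⁻¹ *ᵥ toQ Γ.lam) = Γ.deg none := by
      rw [PlumbingGraph.dotProduct_MQ_inv_comm, hMu, hΓ.inv_mulVec_mulVec, hdot, ← hlam]; rfl
    rw [PlumbingGraph.sq, hinv, dotProduct_add, hdot, toQ_add, add_dotProduct, h1,
      Fintype.sum_option]
    rw [Finset.sum_add_distrib] at hsum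
    have h2 : ∑ i, (toQ Γ.ambient.Mu + toQ Γ.lam) i =
        ∑ i, (Γ.ambient.Mu i : ℚ) + ∑ i, (Γ.lam i : ℚ) := Finset.sum_add_distrib
    rw [h2, ← Finset.sum_add_distrib, Finset.sum_add_distrib, hsum, Finset.sum_add_distrib, sf,
      PlumbingGraph.sq]
    ring
  have hdK : toQ K ⬝ᵥ (Γ.ambient.MQ⁻¹ *ᵥ toQ (Γ.ambient.Mu + Γ.lam)) =
      ∑ i, (K i : ℚ) + toQ K ⬝ᵥ (Γ.ambient.MQ⁻¹ *ᵥ toQ Γ.lam) := by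
    rw [hinv, dotProduct_add, hdot]; rfl
  funext r
  rw [term, latticeTerm, toQ_sub, toQ_zsmul]
  congr 1
  · rw [PlumbingGraph.sq_sub_smul, hsq, hdK, xi, hε2]
    congr 1
    · ring
    · rw [theta, ← hsum, Finset.mul_sum, ← Finset.sum_sub_distrib]
      congr 1
      exact Finset.sum_congr rfl fun i _ => by simp [mul_add]
    · rw [Matrix.mulVec_sub, Matrix.mulVec_smul, dotProduct_sub, dotProduct_smul, hdl, zeta,
        smul_eq_mul]
      congr 1
      ring

variable {Γ} in
/-- The Laplace transform of a summand of the series of the complement is a summand of the series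
of the surgered graph. -/
theorem laplace_latticeTerm (h : (Γ.surgered m₀).IsNegDef) {W : ℕ → ℤ → R} (hW : IsAdmissible W)
    {ε : ℤ} {l : Option ι → ℤ} {a : ℚ}
    (hl : toQ l ⬝ᵥ Γ.Sig = 2 * a - (1 + ε) * Γ.p m₀) :
    laplace (Γ.p m₀) a ε (Γ.latticeTerm W (restrictΓ l)) = (Γ.surgered m₀).latticeTerm W l := by
  have hp := p_ne_zero h
  have hpe := p_eq h
  have hr : toQ (restrictΓ l) = fun i => toQ l (some i) := rfl
  have hl' := hl
  rw [dotProduct_Sig, ← hr, PlumbingGraph.dotProduct_MQ_inv_comm] at hl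
  -- The two monomials of the kernel select neighbouring powers of z. Relative to the power of z
  -- carried by the summand they sit at -(ℓ₀ + 1) and -(ℓ₀ - 1), ℓ₀ being the entry of ℓ at `v₀`.
  have e1 : -2 * (a - (1 + ε) / 2 * Γ.p m₀) - 1 -
      toQ Γ.lam ⬝ᵥ (Γ.ambient.MQ⁻¹ *ᵥ toQ (restrictΓ l)) = ((-(l none + 1) : ℤ) : ℚ) := by
    push_cast
    have : toQ l none = (l none : ℚ) := rfl
    linarith
  have e2 : -2 * (a - (1 + ε) / 2 * Γ.p m₀) + 1 -
      toQ Γ.lam ⬝ᵥ (Γ.ambient.MQ⁻¹ *ᵥ toQ (restrictΓ l)) = ((-(l none - 1) : ℤ) : ℚ) := by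
    push_cast
    have : toQ l none = (l none : ℚ) := rfl
    linarith
  have hsq := surgered_sq h (toQ l)
  rw [hl', ← hr] at hsq
  simp only [laplace, latticeTerm, e1, e2, expansion_intCast, QT.shift_monomial, QT.smul_monomial,
    PlumbingGraph.latticeTerm, hsq, Fintype.prod_option, Fintype.sum_option, Fintype.card_option,
    neg_neg]
  -- Admissibility enters here: the difference of the two values of W_{δ₀+1} is W_{δ₀}(ℓ₀), the
  -- factor of the vertex `v₀`.
  rw [surgered_deg, ← hW.recurrence (Γ.deg none) (l none), mul_comm (_ - _), mul_sub, QT.monomial_sub]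
  have hc : ((Γ.surgered m₀).weight none : ℚ) = Γ.p m₀ + Γ.sf := by
    rw [hpe]; simp [surgered]
  have hw : ∀ i, (Γ.surgered m₀).weight (some i) = Γ.weight i := fun _ => rfl
  have hd : ∀ i, (Γ.surgered m₀).deg (some i) = Γ.deg (some i) := fun _ => rfl
  simp only [hc, hw, hd, restrictΓ]
  -- The number c of the transform is half of ℓ·Σ, so c²/p is the Σ-part of ℓ² divided by 4. The
  -- remaining p combines with `sf` to the weight m₀.
  have hq : -(1 / Γ.p m₀) * (a - (1 + ε) / 2 * Γ.p m₀) ^ 2 + (-3 - Γ.p m₀) / 4 =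
      -(3 + Γ.p m₀) / 4 - (2 * a - (1 + ε) * Γ.p m₀) ^ 2 / Γ.p m₀ / 4 := by
    field_simp
    ring
  rw [hq]
  congr 2 <;> push_cast <;> ring

end MarkedPlumbingGraph

/-! ## Quotients of graphs and connected components -/

/-- Two maps `α : Q → X` and `β : Q → Y` from a set of points onto the vertices of two graphs
identify the second graph with a quotient of the first. -/
theorem SimpleGraph.exists_quot_iso {X Y Q : Type*} (G : SimpleGraph X) (H : SimpleGraph Y)
    (r : X → X → Prop) (α : Q → X) (β : Q → Y)
    (hα : Function.Surjective α) (hβ : Function.Surjective β)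
    (h_fun : ∀ q q', α q = α q' → β q = β q')
    (h_rel : ∀ q q', r (α q) (α q') → β q = β q')
    (h_inj : ∀ q q', β q = β q' → Quot.mk r (α q) = Quot.mk r (α q'))
    (h_lift : ∀ q q', H.Adj (β q) (β q') →
      ∃ q₁ q₂, G.Adj (α q₁) (α q₂) ∧ β q₁ = β q ∧ β q₂ = β q')
    (h_adj : ∀ q q', G.Adj (α q) (α q') → β q ≠ β q' → H.Adj (β q) (β q')) :
    ∃ φ : G.map (Quot.mk r) ≃g H, ∀ q, φ (Quot.mk r (α q)) = β q := by
  choose g hg using hα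
  have hf : ∀ q, β (g (α q)) = β q := fun q => h_fun _ _ (hg _)
  let F : Quot r → Y := Quot.lift (fun x => β (g x)) fun x y hxy => h_rel _ _ (by rwa [hg, hg])
  have hF : ∀ q, F (Quot.mk r (α q)) = β q := hf
  have hmk : ∀ c : Quot r, ∃ q, c = Quot.mk r (α q) := by
    rintro ⟨x⟩
    exact ⟨g x, by rw [hg]⟩
  have hbij : Function.Bijective F := by
    constructor
    · intro c c' h
      obtain ⟨q, rfl⟩ := hmk c
      obtain ⟨q', rfl⟩ := hmk c'
      exact h_inj _ _ (by rwa [hF, hF] at h)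
    · intro y
      obtain ⟨q, rfl⟩ := hβ y
      exact ⟨Quot.mk r (α q), hF q⟩
  refine ⟨⟨Equiv.ofBijective F hbij, ?_⟩, hF⟩
  intro c c'
  obtain ⟨q, rfl⟩ := hmk c
  obtain ⟨q', rfl⟩ := hmk c'
  simp only [Equiv.ofBijective_apply, hF, SimpleGraph.map_adj']
  constructor
  · intro h
    refine ⟨fun e => h.ne (by rw [← hF q, e, hF]), ?_⟩
    obtain ⟨q₁, q₂, ha, h1, h2⟩ := h_lift _ _ h
    exact ⟨_, _, ha, h_inj _ _ h1, h_inj _ _ h2⟩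
  · rintro ⟨hne, x, x', ha, h1, h2⟩
    rw [← hg x, ← hg x'] at ha
    rw [← hg x] at h1
    rw [← hg x'] at h2
    have e1 := congrArg F h1
    have e2 := congrArg F h2
    rw [hF, hF] at e1 e2
    rw [← e1, ← e2]
    -- An edge of `G` whose ends are identified leaves no loop in the image graph, hence only pairs
    -- with distinct images matter.
    refine h_adj _ _ ha fun e => hne ?_
    rw [← h1, ← h2]
    exact h_inj _ _ e

/-! ### Connected components of sets of lattice points. -/

namespace PlumbingGraph

variable {V : Type u} [Fintype V] [DecidableEq V] (P : PlumbingGraph V)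

/-- The connected component of `K` in the graph spanned by `S`. -/
def component (S : Set (V → ℤ)) (K : V → ℤ) : Set (V → ℤ) :=
  {K' | ∃ (h : K ∈ S) (h' : K' ∈ S), (P.latticeGraph.induce S).Reachable ⟨K, h⟩ ⟨K', h'⟩}

variable {P} {S S' : Set (V → ℤ)} {K K' : V → ℤ}

theorem mem_component_self (h : K ∈ S) : K ∈ P.component S K :=
  ⟨h, h, SimpleGraph.Reachable.refl _⟩

theorem component_subset : P.component S K ⊆ S := fun _ h => h.2.1

theorem mem_component_comm (h : K' ∈ P.component S K) : K ∈ P.component S K' :=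
  ⟨h.2.1, h.1, h.2.2.symm⟩

theorem component_eq (h : K' ∈ P.component S K) : P.component S K' = P.component S K := by
  obtain ⟨h1, h2, h3⟩ := h
  ext L
  exact ⟨fun ⟨_, b, c⟩ => ⟨h1, b, h3.trans c⟩, fun ⟨_, b, c⟩ => ⟨h2, b, h3.symm.trans c⟩⟩

/-- Every component is named by a lattice point in it, so nodes of roots can be handled as gradings
together with a point. -/
theorem mem_components_iff {C : Set (V → ℤ)} :
    C ∈ P.components S ↔ ∃ K ∈ S, C = P.component S K := by
  have key : ∀ K : S, Subtype.val '' ((P.latticeGraph.induce S).connectedComponentMk K).supp =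
      P.component S K := by
    intro K
    ext L
    simp only [Set.mem_image, SimpleGraph.ConnectedComponent.mem_supp_iff,
      SimpleGraph.ConnectedComponent.eq, Subtype.exists, exists_and_right, exists_eq_right]
    exact ⟨fun ⟨h, e⟩ => ⟨K.2, h, e.symm⟩, fun ⟨_, h, e⟩ => ⟨h, e.symm⟩⟩
  constructor
  · rintro ⟨c, rfl⟩
    induction c using SimpleGraph.ConnectedComponent.ind with
    | h K => exact ⟨K, K.2, key K⟩
  · rintro ⟨K, hK, rfl⟩
    exact ⟨_, (key ⟨K, hK⟩).symm⟩

theorem component_mono (h : S ⊆ S') : P.component S K ⊆ P.component S' K := by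
  rintro L ⟨h1, h2, h3⟩
  exact ⟨h h1, h h2, h3.map (SimpleGraph.induceHomOfLE _ h).toHom⟩

/-- A component of `S'` containing a given nonempty set is unique, so the union defining
`componentContaining` has a single member. -/
theorem componentContaining_component (h : S ⊆ S') (hK : K ∈ S) :
    P.componentContaining S' (P.component S K) = P.component S' K := by
  apply le_antisymm
  · rintro L ⟨D, ⟨hD, hC⟩, hL⟩
    obtain ⟨K₁, _, rfl⟩ := mem_components_iff.mp hD
    rwa [component_eq (hC (mem_component_self hK))]
  · intro L hL
    exact ⟨_, ⟨mem_components_iff.mpr ⟨K, h hK, rfl⟩, component_mono h⟩, hL⟩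

theorem add_mem_component {i : V} (hK : K ∈ S) (hK' : K + 2 • (P.M *ᵥ Pi.single i 1) ∈ S) :
    K + 2 • (P.M *ᵥ Pi.single i 1) ∈ P.component S K := by
  -- A simple graph has no loops, so a vanishing move must be treated apart.
  by_cases e : K = K + 2 • (P.M *ᵥ Pi.single i 1)
  · rw [← e]
    exact mem_component_self hK
  · refine ⟨hK, hK', SimpleGraph.Adj.reachable ?_⟩
    rw [SimpleGraph.induce_adj, latticeGraph, SimpleGraph.fromRel_adj]
    exact ⟨e, Or.inl ⟨i, rfl⟩⟩

/-- Induction along the paths in `S`. -/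
theorem component_induction {p : (V → ℤ) → Prop} (hp : p K)
    (h_up : ∀ L i, L ∈ S → L + 2 • (P.M *ᵥ Pi.single i 1) ∈ S → p L →
      p (L + 2 • (P.M *ᵥ Pi.single i 1)))
    (h_down : ∀ L i, L ∈ S → L + 2 • (P.M *ᵥ Pi.single i 1) ∈ S →
      p (L + 2 • (P.M *ᵥ Pi.single i 1)) → p L)
    (h : K' ∈ P.component S K) : p K' := by
  obtain ⟨h1, h2, ⟨w⟩⟩ := h
  have key : ∀ (x y : S), (P.latticeGraph.induce S).Walk x y → p x.1 → p y.1 := by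
    intro x y w
    induction w with
    | nil => exact id
    | @cons x z y hxz _ ih =>
      intro hx
      refine ih ?_
      rw [SimpleGraph.induce_adj, latticeGraph, SimpleGraph.fromRel_adj] at hxz
      obtain ⟨_, ⟨i, hi⟩ | ⟨i, hi⟩⟩ := hxz
      · rw [hi]
        exact h_up _ _ x.2 (hi ▸ z.2) hx
      · exact h_down z.1 i z.2 (hi ▸ x.2) (hi ▸ hx)
  exact key _ _ w hp

/-- Translation commutes with the moves 2Me_i. With c = 2λ this carries superlevel sets of h_V to
those of h_U in the next slice. -/
theorem image_add_component (c : V → ℤ) (hS : ∀ L, L ∈ S ↔ L + c ∈ S') :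
    (fun L => L + c) '' P.component S K = P.component S' (K + c) := by
  have e : ∀ L (i : V), L + 2 • (P.M *ᵥ Pi.single i 1) + c = L + c + 2 • (P.M *ᵥ Pi.single i 1) :=
    fun L i => by abel
  apply le_antisymm
  · rintro _ ⟨L, hL, rfl⟩
    refine component_induction (p := fun L => L + c ∈ P.component S' (K + c))
      (mem_component_self ((hS _).mp hL.1)) ?_ ?_ hL
    · intro L i h1 h2 h3
      rw [← component_eq h3, e]
      exact add_mem_component ((hS _).mp h1) (e L i ▸ (hS _).mp h2)
    · intro L i h1 h2 h3
      rw [← component_eq h3, e]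
      exact mem_component_comm
        (add_mem_component ((hS _).mp h1) (e L i ▸ (hS _).mp h2))
  · have e' : ∀ L (i : V), L + 2 • (P.M *ᵥ Pi.single i 1) - c =
        L - c + 2 • (P.M *ᵥ Pi.single i 1) := fun L i => by abel
    have hS' : ∀ L, L ∈ S' ↔ L - c ∈ S := fun L => by rw [hS, sub_add_cancel]
    intro L hL
    refine ⟨L - c, ?_, sub_add_cancel _ _⟩
    refine component_induction (p := fun L => L - c ∈ P.component S K) ?_ ?_ ?_ hL
    · rw [add_sub_cancel_right]
      exact mem_component_self ((hS _).mpr hL.1)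
    · intro L i h1 h2 h3
      rw [← component_eq h3, e']
      exact add_mem_component ((hS' _).mp h1) (e' L i ▸ (hS' _).mp h2)
    · intro L i h1 h2 h3
      rw [← component_eq h3, e']
      exact mem_component_comm
        (add_mem_component ((hS' _).mp h1) (e' L i ▸ (hS' _).mp h2))

theorem superlevel_anti {s : Set (V → ℤ)} {h h' : ℚ} (hh : h ≤ h') :
    P.superlevel s h' ⊆ P.superlevel s h := fun _ hK => ⟨hK.1, hh.trans hK.2⟩

theorem IsNegDef.finite_superlevel (hP : P.IsNegDef) (s : Set (V → ℤ)) (h : ℚ) :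
    (P.superlevel s h).Finite := by
  refine (hP.finite_sq_ge (4 * h - Fintype.card V)).subset fun K hK => ?_
  have := hK.2
  rw [hU] at this
  change (4 * h - Fintype.card V : ℚ) ≤ P.sq (toQ K)
  linarith

theorem mem_gradings_iff (hP : P.IsNegDef) {s : Set (V → ℤ)} (hs : s ∈ P.SpinC) (hK : K ∈ s)
    {h : ℚ} : h ∈ P.gradings s ↔ ∃ n : ℤ, h = 2 * n + P.hU K := by
  constructor
  · rintro ⟨K', hK', n, rfl⟩
    obtain ⟨m, hm⟩ := hP.hU_sub_mem hs hK hK'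
    exact ⟨n + m, by rw [hm]; push_cast; ring⟩
  · rintro ⟨n, rfl⟩
    exact ⟨K, hK, n, rfl⟩

end PlumbingGraph

/-! ## The slices of a spin^c structure -/

namespace PlumbingGraph

variable {V : Type u} [Fintype V] [DecidableEq V] {P : PlumbingGraph V} {s : Set (V → ℤ)}
  {K K' : V → ℤ}

theorem add_mem_of_mem_SpinC (hs : s ∈ P.SpinC) (hK : K ∈ s) (x : V → ℤ) :
    K + 2 • (P.M *ᵥ x) ∈ s := by
  obtain ⟨k, _, rfl⟩ := hs
  obtain ⟨y, rfl⟩ := hK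
  exact ⟨y + x, by rw [Matrix.mulVec_add, smul_add, add_assoc]⟩

theorem exists_eq_add_of_mem_SpinC (hs : s ∈ P.SpinC) (hK : K ∈ s) (hK' : K' ∈ s) :
    ∃ x, K' = K + 2 • (P.M *ᵥ x) := by
  obtain ⟨k, _, rfl⟩ := hs
  obtain ⟨y, rfl⟩ := hK
  obtain ⟨y', rfl⟩ := hK'
  exact ⟨y' - y, by rw [Matrix.mulVec_sub, smul_sub]; abel⟩

theorem mem_Char_of_mem_SpinC (hs : s ∈ P.SpinC) (hK : K ∈ s) : K ∈ P.Char := by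
  obtain ⟨k, ⟨x, rfl⟩, rfl⟩ := hs
  obtain ⟨y, rfl⟩ := hK
  exact ⟨x + P.M *ᵥ y, by rw [smul_add, add_assoc]⟩

theorem root_adj {X : Type v} {w : Set (V → ℤ) → X} {η η' : P.rootNodes s} :
    (P.root s w).graph.Adj η η' ↔ (η'.1.1 = η.1.1 - 2 ∧ η.1.2 ⊆ η'.1.2) ∨
      (η.1.1 = η'.1.1 - 2 ∧ η'.1.2 ⊆ η.1.2) := by
  refine (SimpleGraph.fromRel_adj _ _ _).trans ⟨fun h => h.2, fun h => ⟨?_, h⟩⟩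
  rintro rfl
  rcases h with h | h <;> linarith [h.1]

end PlumbingGraph

namespace MarkedPlumbingGraph

variable {ι : Type u} [Fintype ι] [DecidableEq ι] {Γ : MarkedPlumbingGraph ι} {m₀ : ℤ}
  {t : Set (Option ι → ℤ)} {L L' : Option ι → ℤ} {a : ℚ}

theorem alex_mem_alexSet (hL : L ∈ t) : Γ.alex m₀ L ∈ Γ.alexSet m₀ t := ⟨L, hL, rfl⟩

theorem restrict_mem_spincAt (hL : L ∈ t) : restrictΓ L ∈ Γ.spincAt m₀ t (Γ.alex m₀ L) :=
  ⟨L, hL, rfl, 0, by simp⟩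

section

variable (h : (Γ.surgered m₀).IsNegDef) (ht : t ∈ (Γ.surgered m₀).SpinC)
include h

theorem alex_add_single_some (L : Option ι → ℤ) (i : ι) :
    Γ.alex m₀ (L + 2 • ((Γ.surgered m₀).M *ᵥ Pi.single (some i) 1)) = Γ.alex m₀ L := by
  rw [alex_add_two_mulVec h]
  simp

theorem alex_add_single_none (L : Option ι → ℤ) :
    Γ.alex m₀ (L + 2 • ((Γ.surgered m₀).M *ᵥ Pi.single none 1)) = Γ.alex m₀ L + Γ.p m₀ := by
  rw [alex_add_two_mulVec h]
  simp

theorem restrict_add_single_some (L : Option ι → ℤ) (i : ι) :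
    restrictΓ (L + 2 • ((Γ.surgered m₀).M *ᵥ Pi.single (some i) 1)) =
      restrictΓ L + 2 • (Γ.ambient.M *ᵥ Pi.single i 1) := by
  have : restrictΓ (Pi.single (some i) 1 : Option ι → ℤ) = Pi.single i 1 := by
    ext j; simp [restrictΓ, Pi.single_apply]
  rw [restrict_add_two_mulVec h, this]
  simp

theorem restrict_add_single_none (L : Option ι → ℤ) :
    restrictΓ (L + 2 • ((Γ.surgered m₀).M *ᵥ Pi.single none 1)) =
      restrictΓ L + 2 • Γ.lam := by
  have : restrictΓ (Pi.single none 1 : Option ι → ℤ) = 0 := by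
    ext j; simp [restrictΓ]
  rw [restrict_add_two_mulVec h, this]
  simp [two_smul]

include ht

/-- Moves supported on Γ keep the Alexander grading and restrict to all of 2Mℤ^s. With
`eq_of_alex_eq` this identifies the slice of `t` at `a` with 𝔱_a. -/
theorem exists_lift {K : ι → ℤ} (hK : K ∈ Γ.spincAt m₀ t a) :
    ∃ L ∈ t, Γ.alex m₀ L = a ∧ restrictΓ L = K := by
  obtain ⟨L, hL, rfl, x, rfl⟩ := hK
  refine ⟨L + 2 • ((Γ.surgered m₀).M *ᵥ fun v => v.elim 0 x),
    PlumbingGraph.add_mem_of_mem_SpinC ht hL _, ?_, ?_⟩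
  · rw [alex_add_two_mulVec h]
    simp
  · have : restrictΓ (fun v : Option ι => v.elim 0 x) = x := rfl
    rw [restrict_add_two_mulVec h, this]
    simp

/-- Two elements of `t` with equal Alexander grading differ by 2Mx with p x₀ = 0, so x lives on Γ
because p ≠ 0. -/
theorem spincAt_eq (hL : L ∈ t) :
    Γ.spincAt m₀ t (Γ.alex m₀ L) = Γ.ambient.cls (restrictΓ L) := by
  apply le_antisymm
  · rintro _ ⟨L', hL', ha, y, rfl⟩
    obtain ⟨x, rfl⟩ := PlumbingGraph.exists_eq_add_of_mem_SpinC ht hL hL'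
    rw [alex_add_two_mulVec h] at ha
    have hx : x none = 0 := by
      have : Γ.p m₀ * x none = 0 := by linarith
      simpa [p_ne_zero h] using this
    refine ⟨restrictΓ x + y, ?_⟩
    rw [restrict_add_two_mulVec h, hx, Matrix.mulVec_add, smul_add]
    simp [add_assoc]
  · exact fun K hK => ⟨L, hL, rfl, hK⟩

theorem spincAt_mem_SpinC (ha : a ∈ Γ.alexSet m₀ t) :
    Γ.spincAt m₀ t a ∈ Γ.ambient.SpinC := by
  obtain ⟨L, hL, rfl⟩ := ha
  refine ⟨restrictΓ L, ?_, spincAt_eq h ht hL⟩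
  obtain ⟨x, rfl⟩ := PlumbingGraph.mem_Char_of_mem_SpinC ht hL
  exact ⟨restrictΓ x, rfl⟩

/-- The slice `a + p` is the slice `a` shifted by `2λ`. -/
theorem add_lam_mem_spincAt_iff (K : ι → ℤ) :
    K ∈ Γ.spincAt m₀ t a ↔ K + 2 • Γ.lam ∈ Γ.spincAt m₀ t (a + Γ.p m₀) := by
  constructor
  · intro hK
    obtain ⟨L, hL, rfl, rfl⟩ := exists_lift h ht hK
    rw [← alex_add_single_none h, ← restrict_add_single_none h]
    exact restrict_mem_spincAt (PlumbingGraph.add_mem_of_mem_SpinC ht hL _)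
  · intro hK
    obtain ⟨L, hL, ha, hr⟩ := exists_lift h ht hK
    set L' := L + 2 • ((Γ.surgered m₀).M *ᵥ (-Pi.single none 1)) with hL'
    have e : L' + 2 • ((Γ.surgered m₀).M *ᵥ Pi.single none 1) = L := by
      rw [hL', Matrix.mulVec_neg]; simp
    have ha' := alex_add_single_none h L'
    have hr' := restrict_add_single_none h L'
    rw [e] at ha' hr'
    have e1 : Γ.alex m₀ L' = a := by linarith
    have e2 : restrictΓ L' = K := by
      rw [hr] at hr'
      exact (add_right_cancel hr').symm
    rw [← e1, ← e2]
    exact restrict_mem_spincAt (PlumbingGraph.add_mem_of_mem_SpinC ht hL _)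

end

end MarkedPlumbingGraph

/-! ## The weighted graded root as a collapse of the weighted bigraded root -/

namespace MarkedPlumbingGraph

variable {ι : Type u} [Fintype ι] [DecidableEq ι] {Γ : MarkedPlumbingGraph ι}
  {R : Type v} [CommRing R] {s : Set (ι → ℤ)}

theorem superlevelUV_subset (i j : ℚ) : Γ.superlevelUV s i j ⊆ Γ.ambient.superlevel s i :=
  fun _ h => ⟨h.1, h.2.1⟩

theorem superlevelUV_subset_V (i j : ℚ) : Γ.superlevelUV s i j ⊆ Γ.superlevelV s j :=
  fun _ h => ⟨h.1, h.2.2⟩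

theorem superlevelUV_anti {i i' j j' : ℚ} (hi : i ≤ i') (hj : j ≤ j') :
    Γ.superlevelUV s i' j' ⊆ Γ.superlevelUV s i j :=
  fun _ h => ⟨h.1, hi.trans h.2.1, hj.trans h.2.2⟩

theorem add_lam_mem_SpinC (hs : s ∈ Γ.ambient.SpinC) :
    (fun K => K + 2 • Γ.lam) '' s ∈ Γ.ambient.SpinC := by
  obtain ⟨_, ⟨x, rfl⟩, rfl⟩ := hs
  refine ⟨_, ⟨x + Γ.lam, rfl⟩, ?_⟩
  ext K
  constructor
  · rintro ⟨_, ⟨y, rfl⟩, rfl⟩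
    exact ⟨y, by simp only [smul_add]; abel⟩
  · rintro ⟨y, rfl⟩
    exact ⟨_, ⟨y, rfl⟩, by simp only [smul_add]; abel⟩

theorem mem_gradingsV_iff (hΓ : Γ.ambient.IsNegDef) (hs : s ∈ Γ.ambient.SpinC) {K : ι → ℤ}
    (hK : K ∈ s) {j : ℚ} : j ∈ Γ.gradingsV s ↔ ∃ n : ℤ, j = 2 * n + Γ.hV K := by
  constructor
  · rintro ⟨K', hK', n, rfl⟩
    obtain ⟨m, hm⟩ := hΓ.hU_sub_mem (add_lam_mem_SpinC hs) ⟨K, hK, rfl⟩ ⟨K', hK', rfl⟩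
    exact ⟨n + m, by rw [hV, hV, hm]; push_cast; ring⟩
  · rintro ⟨n, rfl⟩
    exact ⟨K, hK, n, rfl⟩

/-- Points in bigrading `(i, j)`: the lattice points of `s` in the corresponding superlevel set. -/
structure BigradedPoint (Γ : MarkedPlumbingGraph ι) (s : Set (ι → ℤ)) where
  i : ℚ
  j : ℚ
  K : ι → ℤ
  i_mem : i ∈ Γ.ambient.gradings s
  j_mem : j ∈ Γ.gradingsV s
  K_mem : K ∈ Γ.superlevelUV s i j

/-- The node of the bigraded root given by a point. -/
def BigradedPoint.node (q : BigradedPoint Γ s) : Γ.bigradedNodes s :=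
  ⟨((q.i, q.j), Γ.ambient.component (Γ.superlevelUV s q.i q.j) q.K),
    q.i_mem, q.j_mem, PlumbingGraph.mem_components_iff.mpr ⟨q.K, q.K_mem, rfl⟩⟩

/-- The node of the graded root given by a point. -/
def BigradedPoint.rootNode (q : BigradedPoint Γ s) : Γ.ambient.rootNodes s :=
  ⟨(q.i, Γ.ambient.component (Γ.ambient.superlevel s q.i) q.K),
    q.i_mem, PlumbingGraph.mem_components_iff.mpr ⟨q.K, superlevelUV_subset _ _ q.K_mem, rfl⟩⟩

theorem BigradedPoint.node_surjective :
    Function.Surjective (BigradedPoint.node (Γ := Γ) (s := s)) := by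
  rintro ⟨⟨⟨i, j⟩, C⟩, hi, hj, hC⟩
  obtain ⟨K, hK, e⟩ := PlumbingGraph.mem_components_iff.mp hC
  exact ⟨⟨i, j, K, hi, hj, hK⟩, Subtype.ext (Prod.ext rfl e.symm)⟩

theorem BigradedPoint.rootNode_surjective :
    Function.Surjective (BigradedPoint.rootNode (Γ := Γ) (s := s)) := by
  rintro ⟨⟨i, C⟩, hi, hC⟩
  obtain ⟨K, hK, e⟩ := PlumbingGraph.mem_components_iff.mp hC
  exact ⟨⟨i, Γ.hV K, K, hi, ⟨K, hK.1, 0, by simp⟩, hK.1, hK.2, le_rfl⟩,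
    Subtype.ext (Prod.ext rfl e.symm)⟩

theorem BigradedPoint.rootNode_eq {q q' : BigradedPoint Γ s} (hi : q.i = q'.i)
    (hK : q'.K ∈ Γ.ambient.component (Γ.ambient.superlevel s q.i) q.K) :
    q.rootNode = q'.rootNode := by
  apply Subtype.ext
  simp only [rootNode, ← hi, PlumbingGraph.component_eq hK]

theorem BigradedPoint.mem_component (q : BigradedPoint Γ s) :
    q.K ∈ Γ.ambient.component (Γ.superlevelUV s q.i q.j) q.K :=
  PlumbingGraph.mem_component_self q.K_mem

theorem BigradedPoint.coordinate_fst (q : BigradedPoint Γ s) :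
    (Γ.coordinate s q.node.1).1 = q.rootNode.1 :=
  Prod.ext rfl (PlumbingGraph.componentContaining_component (superlevelUV_subset _ _) q.K_mem)

/-- Lower the second grading. -/
def BigradedPoint.lower (q : BigradedPoint Γ s) (n : ℕ) : BigradedPoint Γ s where
  i := q.i
  j := q.j - 2 * n
  K := q.K
  i_mem := q.i_mem
  j_mem := by
    obtain ⟨k, hk, m, hm⟩ := q.j_mem
    exact ⟨k, hk, m - n, by rw [hm]; push_cast; ring⟩
  K_mem := ⟨q.K_mem.1, q.K_mem.2.1, by
    have := q.K_mem.2.2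
    have : (0 : ℚ) ≤ n := Nat.cast_nonneg n
    linarith⟩

theorem weightedBigradedRoot_adj {W : ℕ → ℤ → R} {ε : ℤ} {ν ν' : Γ.bigradedNodes s} :
    (Γ.weightedBigradedRoot W ε s).graph.Adj ν ν' ↔
      ((ν'.1.1 = (ν.1.1.1 + 2, ν.1.1.2) ∨ ν'.1.1 = (ν.1.1.1, ν.1.1.2 + 2)) ∧ ν'.1.2 ⊆ ν.1.2) ∨
      ((ν.1.1 = (ν'.1.1.1 + 2, ν'.1.1.2) ∨ ν.1.1 = (ν'.1.1.1, ν'.1.1.2 + 2)) ∧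
        ν.1.2 ⊆ ν'.1.2) := by
  refine (SimpleGraph.fromRel_adj _ _ _).trans ⟨fun h => h.2, fun h => ⟨?_, h⟩⟩
  rintro rfl
  simp [Prod.ext_iff] at h

variable (W : ℕ → ℤ → R) (ε : ℤ)

theorem BigradedPoint.mk_lower (q : BigradedPoint Γ s) (n : ℕ) :
    Quot.mk (Γ.weightedBigradedRoot W ε s).VEdge q.node =
      Quot.mk (Γ.weightedBigradedRoot W ε s).VEdge (q.lower n).node := by
  induction n with
  | zero => simp [lower]
  | succ n ih =>
    rw [ih]
    have hj : (q.lower n).j = (q.lower (n + 1)).j + 2 := by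
      simp only [lower]; push_cast; ring
    exact Quot.sound ⟨rfl, weightedBigradedRoot_adj.mpr (Or.inr ⟨Or.inr (Prod.ext rfl hj),
      PlumbingGraph.component_mono (superlevelUV_anti le_rfl (by rw [hj]; linarith))⟩)⟩

/-- On the finite superlevel set at i, h_V has a lower bound `B`. Descending along V-edges to some j
≤ `B` makes the condition on h_V void, so both points reach the same node. -/
theorem BigradedPoint.mk_eq (hΓ : Γ.ambient.IsNegDef) (hs : s ∈ Γ.ambient.SpinC)
    {q q' : BigradedPoint Γ s} (h : q.rootNode = q'.rootNode) :
    Quot.mk (Γ.weightedBigradedRoot W ε s).VEdge q.node =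
      Quot.mk (Γ.weightedBigradedRoot W ε s).VEdge q'.node := by
  obtain ⟨B, hB⟩ := ((hΓ.finite_superlevel s q.i).image Γ.hV).bddBelow
  have hB' : ∀ K ∈ Γ.ambient.superlevel s q.i, B ≤ Γ.hV K := fun K hK => hB ⟨K, hK, rfl⟩
  have hi : q.i = q'.i := congrArg (fun x => x.1.1) h
  have hC : Γ.ambient.component (Γ.ambient.superlevel s q.i) q.K =
      Γ.ambient.component (Γ.ambient.superlevel s q'.i) q'.K := congrArg (fun x => x.1.2) h
  obtain ⟨m, hm⟩ := (mem_gradingsV_iff hΓ hs q.K_mem.1).mp q.j_mem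
  obtain ⟨m', hm'⟩ := (mem_gradingsV_iff hΓ hs q.K_mem.1).mp q'.j_mem
  obtain ⟨N, hN⟩ := exists_nat_ge (max (q.j - B) (q'.j - B))
  have hN1 := (le_max_left _ _).trans hN
  have hN2 := (le_max_right _ _).trans hN
  -- `N` brings both second gradings below `B`; the truncated differences lower the higher of the
  -- two further, so that they become equal.
  set n := N + (m - m').toNat
  set n' := N + (m' - m).toNat
  have hnn : (m : ℤ) - n = m' - n' := by omega
  have hj : (q.lower n).j = (q'.lower n').j := by
    have : (m : ℚ) - n = m' - n' := by exact_mod_cast hnn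
    simp only [lower]
    linarith
  have hjB : (q.lower n).j ≤ B := by
    have h1 : (N : ℚ) ≤ n := by exact_mod_cast Nat.le_add_right _ _
    have h2 : (0 : ℚ) ≤ N := Nat.cast_nonneg N
    simp only [lower]
    linarith
  have hS : Γ.superlevelUV s q.i (q.lower n).j = Γ.ambient.superlevel s q.i :=
    Set.Subset.antisymm (superlevelUV_subset _ _)
      fun K hK => ⟨hK.1, hK.2, hjB.trans (hB' K hK)⟩
  rw [q.mk_lower W ε n, q'.mk_lower W ε n']
  congr 1
  apply Subtype.ext
  refine Prod.ext (Prod.ext hi hj) ?_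
  change Γ.ambient.component (Γ.superlevelUV s q.i (q.lower n).j) q.K =
    Γ.ambient.component (Γ.superlevelUV s q'.i (q'.lower n').j) q'.K
  rw [← hj, ← hi, hS, hC, hi]

/-- Under passage to components for h_U, a U-edge stays an edge and a V-edge is contracted, since
the first grading does not change along it. -/
theorem BigradedPoint.rootNode_eq_or_adj {q q' : BigradedPoint Γ s}
    (h : (Γ.weightedBigradedRoot W ε s).graph.Adj q.node q'.node) :
    q.rootNode = q'.rootNode ∨ (Γ.weightedRoot W ε s).graph.Adj q.rootNode q'.rootNode := by
  have key : ∀ q q' : BigradedPoint Γ s,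
      (q'.node.1.1 = (q.i + 2, q.j) ∨ q'.node.1.1 = (q.i, q.j + 2)) ∧
        q'.node.1.2 ⊆ q.node.1.2 →
      q.rootNode = q'.rootNode ∨ (Γ.weightedRoot W ε s).graph.Adj q.rootNode q'.rootNode := by
    rintro q q' ⟨hb, hsub⟩
    have hmem : q'.K ∈ Γ.ambient.component (Γ.ambient.superlevel s q.i) q.K :=
      PlumbingGraph.component_mono (superlevelUV_subset _ _) (hsub q'.mem_component)
    rcases hb with hb | hb
    · right
      have hi : q'.i = q.i + 2 := congrArg Prod.fst hb
      refine PlumbingGraph.root_adj.mpr (Or.inr ⟨?_, ?_⟩)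
      · change q.i = q'.i - 2
        linarith
      · change Γ.ambient.component (Γ.ambient.superlevel s q'.i) q'.K ⊆
          Γ.ambient.component (Γ.ambient.superlevel s q.i) q.K
        rw [← PlumbingGraph.component_eq hmem]
        exact PlumbingGraph.component_mono (PlumbingGraph.superlevel_anti (by linarith))
    · left
      exact rootNode_eq (congrArg Prod.fst hb).symm hmem
  rcases weightedBigradedRoot_adj.mp h with h | h
  · exact key q q' h
  · exact (key q' q h).imp Eq.symm SimpleGraph.Adj.symm

/-- The point of the upper node, kept at the same second grading, represents the lower node as well;
this exhibits the edge as a U-edge. -/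
theorem BigradedPoint.exists_adj {q q' : BigradedPoint Γ s}
    (h : (Γ.weightedRoot W ε s).graph.Adj q.rootNode q'.rootNode) :
    ∃ q₁ q₂ : BigradedPoint Γ s, (Γ.weightedBigradedRoot W ε s).graph.Adj q₁.node q₂.node ∧
      q₁.rootNode = q.rootNode ∧ q₂.rootNode = q'.rootNode := by
  have key : ∀ q q' : BigradedPoint Γ s,
      q'.rootNode.1.1 = q.rootNode.1.1 - 2 ∧ q.rootNode.1.2 ⊆ q'.rootNode.1.2 →
      ∃ q₁ q₂ : BigradedPoint Γ s, (Γ.weightedBigradedRoot W ε s).graph.Adj q₁.node q₂.node ∧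
      q₁.rootNode = q.rootNode ∧ q₂.rootNode = q'.rootNode := by
    rintro q q' ⟨hi, hsub⟩
    have hi : q'.i = q.i - 2 := hi
    have hmem : q.K ∈ Γ.ambient.component (Γ.ambient.superlevel s q'.i) q'.K :=
      hsub (PlumbingGraph.mem_component_self (superlevelUV_subset _ _ q.K_mem))
    have hle : q'.i ≤ Γ.ambient.hU q.K := by
      have := q.K_mem.2.1
      linarith
    let q₂ : BigradedPoint Γ s :=
      ⟨q'.i, q.j, q.K, q'.i_mem, q.j_mem, q.K_mem.1, hle, q.K_mem.2.2⟩
    refine ⟨q, q₂, ?_, rfl, (rootNode_eq (q := q') (q' := q₂) rfl hmem).symm⟩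
    refine weightedBigradedRoot_adj.mpr (Or.inr ⟨Or.inl (Prod.ext ?_ rfl), ?_⟩)
    · change q.i = q'.i + 2
      linarith
    · exact PlumbingGraph.component_mono (superlevelUV_anti (by change q'.i ≤ q.i; linarith) le_rfl)
  rcases PlumbingGraph.root_adj.mp h with h | h
  · exact key q q' h
  · obtain ⟨q₁, q₂, h1, h2, h3⟩ := key q' q h
    exact ⟨q₂, q₁, h1.symm, h3, h2⟩

/-- The weighted graded root is the collapse of the weighted bigraded root. -/
theorem exists_collapseU_iso (hΓ : Γ.ambient.IsNegDef) (hs : s ∈ Γ.ambient.SpinC) :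
    ∃ φ : (Γ.weightedBigradedRoot W ε s).collapseU.Iso (Γ.weightedRoot W ε s),
      ∀ ν : (Γ.weightedBigradedRoot W ε s).Node,
        (φ.toIso (Quot.mk _ ν)).1 = (Γ.coordinate s ν.1).1 := by
  obtain ⟨φ, hφ⟩ := SimpleGraph.exists_quot_iso (Γ.weightedBigradedRoot W ε s).graph
    (Γ.weightedRoot W ε s).graph (Γ.weightedBigradedRoot W ε s).VEdge
    BigradedPoint.node BigradedPoint.rootNode BigradedPoint.node_surjective
    BigradedPoint.rootNode_surjective
    (fun q q' e => Subtype.ext (by rw [← q.coordinate_fst, ← q'.coordinate_fst, e]))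
    -- A V-edge fixes the first grading, while an edge of the root changes it by 2; only equality
    -- remains.
    (fun q q' e => (BigradedPoint.rootNode_eq_or_adj W ε e.2).resolve_right fun ha => by
      have hi : q.i = q'.i := e.1
      rcases PlumbingGraph.root_adj.mp ha with h | h
      · have : q'.i = q.i - 2 := h.1
        linarith
      · have : q.i = q'.i - 2 := h.1
        linarith)
    (fun q q' e => BigradedPoint.mk_eq W ε hΓ hs e)
    (fun q q' e => BigradedPoint.exists_adj W ε e)
    (fun q q' e hne => (BigradedPoint.rootNode_eq_or_adj W ε e).resolve_left hne)
  have hc : ∀ ν : (Γ.weightedBigradedRoot W ε s).Node,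
      (φ (Quot.mk _ ν)).1 = (Γ.coordinate s ν.1).1 := by
    intro ν
    obtain ⟨q, rfl⟩ := BigradedPoint.node_surjective ν
    rw [hφ, q.coordinate_fst]
  refine ⟨⟨φ, ?_, ?_⟩, hc⟩
  · rintro ⟨ν⟩
    exact congrArg Prod.fst (hc ν)
  · intro c
    -- The collapsed weight is read at a chosen representative; its first coordinate is the image of
    -- the class, so the choice is immaterial.
    have h1 : Quot.mk _ (Quot.out c) = c := Quot.out_eq c
    have h2 := congrArg Prod.snd (hc (Quot.out c))
    rw [h1] at h2
    exact congrArg (Γ.compWeight W ε) h2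

end MarkedPlumbingGraph

/-! ## The weighted graded root of the surgered graph -/

namespace MarkedPlumbingGraph

variable {ι : Type u} [Fintype ι] [DecidableEq ι] {Γ : MarkedPlumbingGraph ι} {m₀ : ℤ}
  {t : Set (Option ι → ℤ)} {R : Type v} [CommRing R]

theorem BigradedPoint.coordinate_snd {s s' : Set (ι → ℤ)} (q : BigradedPoint Γ s)
    (hs : ∀ K, K ∈ s ↔ K + 2 • Γ.lam ∈ s') :
    (Γ.coordinate s q.node.1).2 =
      (q.j, Γ.ambient.component (Γ.ambient.superlevel s' q.j) (q.K + 2 • Γ.lam)) := by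
  refine Prod.ext rfl ?_
  change (fun K => K + 2 • Γ.lam) '' Γ.ambient.componentContaining (Γ.superlevelV s q.j)
    (Γ.ambient.component (Γ.superlevelUV s q.i q.j) q.K) = _
  rw [PlumbingGraph.componentContaining_component (superlevelUV_subset_V _ _) q.K_mem,
    PlumbingGraph.image_add_component]
  exact fun K => and_congr_left' (hs K)

/-- The superlevel set of the slice `a` in the grading `h` of the surgered graph. -/
def sliceSuperlevel (Γ : MarkedPlumbingGraph ι) (m₀ : ℤ) (t : Set (Option ι → ℤ)) (a h : ℚ) :
    Set (ι → ℤ) :=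
  Γ.ambient.superlevel (Γ.spincAt m₀ t a) (h + sigmaShift (Γ.p m₀) a)

/-! ### Lifting paths from a slice to the surgered lattice. -/

section

variable (hneg : (Γ.surgered m₀).IsNegDef)
include hneg

theorem mem_superlevel_iff {L : Option ι → ℤ} (hL : L ∈ t) {h : ℚ} :
    L ∈ (Γ.surgered m₀).superlevel t h ↔
      restrictΓ L ∈ Γ.sliceSuperlevel m₀ t (Γ.alex m₀ L) h := by
  have := hU_surgered hneg L
  constructor
  · exact fun hL' => ⟨restrict_mem_spincAt hL, by linarith [hL'.2]⟩
  · exact fun hL' => ⟨hL, by linarith [hL'.2]⟩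

variable (ht : t ∈ (Γ.surgered m₀).SpinC)
include ht

/-- A path in a slice lifts step by step: each move at a vertex of Γ is the restriction of the same
move upstairs, and both superlevel conditions agree by `hU_surgered`. -/
theorem mem_component_of_restrict_mem {L L' : Option ι → ℤ} {h : ℚ} (hL : L ∈ t) (hL' : L' ∈ t)
    (ha : Γ.alex m₀ L' = Γ.alex m₀ L)
    (hr : restrictΓ L' ∈
      Γ.ambient.component (Γ.sliceSuperlevel m₀ t (Γ.alex m₀ L) h) (restrictΓ L)) :
    L' ∈ (Γ.surgered m₀).component ((Γ.surgered m₀).superlevel t h) L := by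
  have hmem : ∀ M ∈ t, Γ.alex m₀ M = Γ.alex m₀ L →
      restrictΓ M ∈ Γ.sliceSuperlevel m₀ t (Γ.alex m₀ L) h →
      M ∈ (Γ.surgered m₀).superlevel t h := by
    intro M hM haM hrM
    rw [mem_superlevel_iff hneg hM, haM]
    exact hrM
  -- The induction runs over points of the slice and asserts the claim for every lift with the fixed
  -- Alexander grading; such a lift is unique.
  refine PlumbingGraph.component_induction (p := fun x => ∀ M ∈ t, Γ.alex m₀ M = Γ.alex m₀ L →
    restrictΓ M = x → M ∈ (Γ.surgered m₀).component ((Γ.surgered m₀).superlevel t h) L)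
    ?_ ?_ ?_ hr L' hL' ha rfl
  · intro M hM haM hrM
    obtain rfl := eq_of_alex_eq Γ m₀ haM hrM
    exact PlumbingGraph.mem_component_self (hmem M hM haM hr.1)
  · intro x i hx hx' ih M hM haM hrM
    obtain ⟨M', hM', haM', hrM'⟩ := exists_lift hneg ht hx.1
    have e : M = M' + 2 • ((Γ.surgered m₀).M *ᵥ Pi.single (some i) 1) := by
      refine eq_of_alex_eq Γ (m₀ := m₀) ?_ ?_
      · rw [haM, alex_add_single_some hneg, haM']
      · rw [hrM, restrict_add_single_some hneg, hrM']
    rw [← PlumbingGraph.component_eq (ih M' hM' haM' hrM'), e]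
    refine PlumbingGraph.add_mem_component (hmem M' hM' haM' (hrM' ▸ hx)) ?_
    rw [← e]
    exact hmem M hM haM (hrM ▸ hx')
  · intro x i hx hx' ih M hM haM hrM
    have hM' := PlumbingGraph.add_mem_of_mem_SpinC ht hM (Pi.single (some i) 1)
    have haM' := alex_add_single_some hneg M i
    have hrM' := restrict_add_single_some hneg M i
    rw [haM] at haM'
    rw [hrM] at hrM'
    rw [← PlumbingGraph.component_eq (ih _ hM' haM' hrM')]
    exact PlumbingGraph.mem_component_comm (PlumbingGraph.add_mem_component
      (hmem M hM haM (hrM ▸ hx)) (hmem _ hM' haM' (hrM' ▸ hx')))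

end

/-- Points of the graded root of the surgered graph: lattice points of `t` in the superlevel set of
a grading. -/
structure SurgeredPoint (Γ : MarkedPlumbingGraph ι) (m₀ : ℤ) (t : Set (Option ι → ℤ)) where
  h : ℚ
  L : Option ι → ℤ
  h_mem : h ∈ (Γ.surgered m₀).gradings t
  L_mem : L ∈ (Γ.surgered m₀).superlevel t h

namespace SurgeredPoint

/-- The node of the graded root of the surgered graph given by a point. -/
def rootNode (q : SurgeredPoint Γ m₀ t) : (Γ.surgered m₀).rootNodes t :=
  ⟨(q.h, (Γ.surgered m₀).component ((Γ.surgered m₀).superlevel t q.h) q.L),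
    q.h_mem, PlumbingGraph.mem_components_iff.mpr ⟨q.L, q.L_mem, rfl⟩⟩

/-- The Alexander grading of a point. -/
def alex (q : SurgeredPoint Γ m₀ t) : ℚ := Γ.alex m₀ q.L

/-- The component of a point in its slice. -/
def sliceComponent (q : SurgeredPoint Γ m₀ t) : Set (ι → ℤ) :=
  Γ.ambient.component (Γ.sliceSuperlevel m₀ t q.alex q.h) (restrictΓ q.L)

theorem rootNode_surjective : Function.Surjective (rootNode (Γ := Γ) (m₀ := m₀) (t := t)) := by
  rintro ⟨⟨h, C⟩, hh, hC⟩
  obtain ⟨L, hL, e⟩ := PlumbingGraph.mem_components_iff.mp hC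
  exact ⟨⟨h, L, hh, hL⟩, Subtype.ext (Prod.ext rfl e.symm)⟩

theorem rootNode_eq_iff {q q' : SurgeredPoint Γ m₀ t} :
    q.rootNode = q'.rootNode ↔ q.h = q'.h ∧
      q'.L ∈ (Γ.surgered m₀).component ((Γ.surgered m₀).superlevel t q.h) q.L := by
  constructor
  · intro e
    have hh : q.h = q'.h := congrArg (fun x => x.1.1) e
    refine ⟨hh, ?_⟩
    have e2 : (Γ.surgered m₀).component ((Γ.surgered m₀).superlevel t q.h) q.L =
      (Γ.surgered m₀).component ((Γ.surgered m₀).superlevel t q'.h) q'.L :=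
      congrArg (fun x => x.1.2) e
    rw [e2]
    exact PlumbingGraph.mem_component_self q'.L_mem
  · rintro ⟨hh, hL⟩
    apply Subtype.ext
    simp only [rootNode, ← hh, PlumbingGraph.component_eq hL]

variable (hneg : (Γ.surgered m₀).IsNegDef) (ht : t ∈ (Γ.surgered m₀).SpinC)

include hneg in
theorem restrict_mem (q : SurgeredPoint Γ m₀ t) :
    restrictΓ q.L ∈ Γ.sliceSuperlevel m₀ t q.alex q.h :=
  (mem_superlevel_iff hneg q.L_mem.1).mp q.L_mem

include hneg in
theorem restrict_mem_sliceComponent (q : SurgeredPoint Γ m₀ t) :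
    restrictΓ q.L ∈ q.sliceComponent :=
  PlumbingGraph.mem_component_self (q.restrict_mem hneg)

/-- The node of its slice given by a point. -/
def ambientNode (q : SurgeredPoint Γ m₀ t) :
    Γ.ambient.rootNodes (Γ.spincAt m₀ t q.alex) :=
  ⟨(q.h + sigmaShift (Γ.p m₀) q.alex, q.sliceComponent), by
    obtain ⟨n, hn⟩ := (PlumbingGraph.mem_gradings_iff hneg ht q.L_mem.1).mp q.h_mem
    refine ⟨restrictΓ q.L, restrict_mem_spincAt q.L_mem.1, n, ?_⟩
    rw [hU_surgered hneg] at hn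
    simp only [hn, alex]
    ring,
    PlumbingGraph.mem_components_iff.mpr ⟨restrictΓ q.L, q.restrict_mem hneg, rfl⟩⟩

variable (W : ℕ → ℤ → R) (ε : ℤ)

/-- The node of the disjoint union of the slices given by a point. -/
def sliceNode (q : SurgeredPoint Γ m₀ t) : (Γ.slices W ε m₀ t).Node :=
  ⟨⟨q.alex, alex_mem_alexSet q.L_mem.1⟩, q.ambientNode hneg ht⟩

/-- The node types vary with the slice, so equality is tested on the underlying gradings and sets.
-/
theorem sliceNode_ext {x y : (Γ.slices W ε m₀ t).Node} (h1 : (x.1 : ℚ) = y.1)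
    (h2 : (x.2 : Γ.ambient.rootNodes (Γ.spincAt m₀ t x.1)).1 =
      (y.2 : Γ.ambient.rootNodes (Γ.spincAt m₀ t y.1)).1) : x = y := by
  obtain ⟨⟨a, ha⟩, η⟩ := x
  obtain ⟨⟨b, hb⟩, η'⟩ := y
  obtain rfl : a = b := h1
  obtain rfl : η = η' := Subtype.ext h2
  rfl

theorem sliceNode_surjective :
    Function.Surjective (sliceNode hneg ht W ε) := by
  rintro ⟨⟨a, ha⟩, ⟨⟨i, C⟩, hi, hC⟩⟩
  obtain ⟨K, hK, e⟩ := PlumbingGraph.mem_components_iff.mp hC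
  obtain ⟨L, hL, rfl, rfl⟩ := exists_lift hneg ht hK.1
  have hs := spincAt_mem_SpinC hneg ht ha
  obtain ⟨n, hn⟩ :=
    (PlumbingGraph.mem_gradings_iff (ambient_isNegDef hneg) hs hK.1).mp hi
  have hU := hU_surgered hneg L
  have hi' : i - sigmaShift (Γ.p m₀) (Γ.alex m₀ L) + sigmaShift (Γ.p m₀) (Γ.alex m₀ L) = i :=
    sub_add_cancel _ _
  have hn : i = 2 * n + Γ.ambient.hU (restrictΓ L) := hn
  have hK2 : i ≤ Γ.ambient.hU (restrictΓ L) := hK.2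
  -- Subtracting σ(a) converts the grading inside the slice to the grading of the surgered root.
  refine ⟨⟨i - sigmaShift (Γ.p m₀) (Γ.alex m₀ L), L, ⟨L, hL, n, ?_⟩, hL, ?_⟩, ?_⟩
  · rw [hU, hn]
    ring
  · linarith
  · refine sliceNode_ext W ε rfl (Prod.ext hi' ?_)
    refine Eq.trans ?_ e.symm
    simp only [sliceNode, ambientNode, sliceComponent, sliceSuperlevel, alex, hi']

theorem sliceNode_eq_iff {q q' : SurgeredPoint Γ m₀ t} :
    q.sliceNode hneg ht W ε = q'.sliceNode hneg ht W ε ↔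
      q'.alex = q.alex ∧ q.h = q'.h ∧ restrictΓ q'.L ∈ q.sliceComponent := by
  constructor
  · intro e
    have h1 : q.alex = q'.alex := congrArg (fun x => (x.1 : ℚ)) e
    have h2 : q.h + sigmaShift (Γ.p m₀) q.alex = q'.h + sigmaShift (Γ.p m₀) q'.alex :=
      congrArg (fun x : (Γ.slices W ε m₀ t).Node =>
        (x.2 : Γ.ambient.rootNodes (Γ.spincAt m₀ t x.1)).1.1) e
    have h3 : q.sliceComponent = q'.sliceComponent :=
      congrArg (fun x : (Γ.slices W ε m₀ t).Node =>
        (x.2 : Γ.ambient.rootNodes (Γ.spincAt m₀ t x.1)).1.2) e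
    refine ⟨h1.symm, ?_, h3 ▸ q'.restrict_mem_sliceComponent hneg⟩
    rw [h1] at h2
    exact add_right_cancel h2
  · rintro ⟨h1, h2, h3⟩
    refine sliceNode_ext W ε h1.symm (Prod.ext ?_ ?_)
    · change q.h + sigmaShift (Γ.p m₀) q.alex = q'.h + sigmaShift (Γ.p m₀) q'.alex
      rw [h1, h2]
    · change q.sliceComponent = q'.sliceComponent
      unfold sliceComponent at h3 ⊢
      rw [← PlumbingGraph.component_eq h3, h1, h2]

theorem grading_sliceNode (q : SurgeredPoint Γ m₀ t) :
    (Γ.slices W ε m₀ t).grading (q.sliceNode hneg ht W ε) = q.h := by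
  change q.h + sigmaShift (Γ.p m₀) q.alex + -sigmaShift (Γ.p m₀) q.alex = q.h
  ring

include hneg ht in
theorem rootNode_eq_of_mem_sliceComponent {q q' : SurgeredPoint Γ m₀ t} (h1 : q'.alex = q.alex)
    (h2 : q.h = q'.h) (h3 : restrictΓ q'.L ∈ q.sliceComponent) : q.rootNode = q'.rootNode :=
  rootNode_eq_iff.mpr
    ⟨h2, mem_component_of_restrict_mem hneg ht q.L_mem.1 q'.L_mem.1 h1 h3⟩

/-- A bigraded node contains a point K lying in the first component, with K + 2λ in the second.
Their lifts differ by the move at `v₀` and both lie in the superlevel set, so they are adjacent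
there. -/
theorem rootNode_eq_of_glue {q q' : SurgeredPoint Γ m₀ t}
    (e : (Γ.slices W ε m₀ t).Glue (Γ.glue W ε m₀ t) (q.sliceNode hneg ht W ε)
      (q'.sliceNode hneg ht W ε)) : q.rootNode = q'.rootNode := by
  obtain ⟨hh, ha, ν, hν⟩ := e
  rw [grading_sliceNode, grading_sliceNode] at hh
  have ha : q'.alex = q.alex + Γ.p m₀ := ha
  obtain ⟨b, hb⟩ := BigradedPoint.node_surjective (Γ := Γ) (s := Γ.spincAt m₀ t q.alex) ν
  subst hb
  have h1 : (Γ.coordinate (Γ.spincAt m₀ t q.alex) b.node.1).1 = (q.ambientNode hneg ht).1 :=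
    congrArg Prod.fst hν
  have h2 : (Γ.coordinate (Γ.spincAt m₀ t q.alex) b.node.1).2 = (q'.ambientNode hneg ht).1 :=
    congrArg Prod.snd hν
  rw [b.coordinate_fst] at h1
  rw [b.coordinate_snd (add_lam_mem_spincAt_iff hneg ht), ← ha] at h2
  have hi : b.i = q.h + sigmaShift (Γ.p m₀) q.alex := congrArg Prod.fst h1
  have hj : b.j = q'.h + sigmaShift (Γ.p m₀) q'.alex := congrArg Prod.fst h2
  have hC : Γ.ambient.component (Γ.ambient.superlevel (Γ.spincAt m₀ t q.alex) b.i) b.K =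
    q.sliceComponent := congrArg Prod.snd h1
  have hC' : Γ.ambient.component (Γ.ambient.superlevel (Γ.spincAt m₀ t q'.alex) b.j)
    (b.K + 2 • Γ.lam) = q'.sliceComponent := congrArg Prod.snd h2
  have hbK := b.K_mem
  have hK : b.K ∈ q.sliceComponent := by
    rw [← hC]
    exact PlumbingGraph.mem_component_self ⟨hbK.1, hbK.2.1⟩
  have hK' : b.K + 2 • Γ.lam ∈ q'.sliceComponent := by
    rw [← hC']
    refine PlumbingGraph.mem_component_self ⟨?_, hbK.2.2⟩
    rw [ha]
    exact (add_lam_mem_spincAt_iff hneg ht _).mp hbK.1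
  obtain ⟨L, hL, haL, hrL⟩ := exists_lift hneg ht hbK.1
  have m1 := mem_component_of_restrict_mem hneg ht q.L_mem.1 hL haL (by rw [hrL]; exact hK)
  have hL' := PlumbingGraph.add_mem_of_mem_SpinC ht hL (Pi.single none 1)
  have m2 := mem_component_of_restrict_mem hneg ht q'.L_mem.1 hL'
    (by rw [alex_add_single_none hneg, haL, ← ha]; rfl)
    (by rw [restrict_add_single_none hneg, hrL]; exact hK')
  rw [← hh] at m2
  refine rootNode_eq_iff.mpr ⟨hh, ?_⟩
  have m3 := PlumbingGraph.add_mem_component m1.2.1 m2.2.1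
  rw [← PlumbingGraph.component_eq m1, ← PlumbingGraph.component_eq m3]
  exact PlumbingGraph.mem_component_comm m2

/-- A move at a vertex of Γ stays within one slice node. A move at `v₀` is an instance of the
gluing. -/
theorem mk_sliceNode_add_single {q q' : SurgeredPoint Γ m₀ t} (hh : q.h = q'.h) (v : Option ι)
    (hL : q'.L = q.L + 2 • ((Γ.surgered m₀).M *ᵥ Pi.single v 1)) :
    Quot.mk ((Γ.slices W ε m₀ t).Glue (Γ.glue W ε m₀ t)) (q.sliceNode hneg ht W ε) =
      Quot.mk ((Γ.slices W ε m₀ t).Glue (Γ.glue W ε m₀ t)) (q'.sliceNode hneg ht W ε) := by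
  cases v with
  | some i =>
    congr 1
    have ha : q'.alex = q.alex := by
      rw [alex, hL, alex_add_single_some hneg]; rfl
    refine (sliceNode_eq_iff hneg ht W ε).mpr ⟨ha, hh, ?_⟩
    have h1 := q.restrict_mem hneg
    have h2 := q'.restrict_mem hneg
    rw [ha, ← hh, hL, restrict_add_single_some hneg] at h2
    rw [hL, restrict_add_single_some hneg]
    exact PlumbingGraph.add_mem_component h1 h2
  | none =>
    have ha : q'.alex = q.alex + Γ.p m₀ := by
      rw [alex, hL, alex_add_single_none hneg]; rfl
    have hr : restrictΓ q'.L = restrictΓ q.L + 2 • Γ.lam := by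
      rw [hL, restrict_add_single_none hneg]
    have h1 := q.restrict_mem hneg
    have h2 := q'.restrict_mem hneg
    have hi := (q.ambientNode hneg ht).2.1
    have hj := (q'.ambientNode hneg ht).2.1
    obtain ⟨n, hn⟩ := (PlumbingGraph.mem_gradings_iff (ambient_isNegDef hneg)
      (spincAt_mem_SpinC hneg ht (alex_mem_alexSet q'.L_mem.1)) h2.1).mp hj
    -- The restriction of `q.L` satisfies both bounds, the second because adding 2λ to it gives the
    -- restriction of `q'.L`. Its bigraded node witnesses the identification.
    let b : BigradedPoint Γ (Γ.spincAt m₀ t q.alex) :=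
      ⟨q.h + sigmaShift (Γ.p m₀) q.alex, q'.h + sigmaShift (Γ.p m₀) q'.alex, restrictΓ q.L,
        hi, ⟨_, h1.1, n, by rw [hV, ← hr]; exact hn⟩, h1.1, h1.2, by
          rw [hV, ← hr]; exact h2.2⟩
    refine Quot.sound ⟨?_, ha, b.node, ?_⟩
    · rw [grading_sliceNode, grading_sliceNode, hh]
    · refine Prod.ext ?_ ?_
      · exact b.coordinate_fst
      · refine (b.coordinate_snd (add_lam_mem_spincAt_iff hneg ht)).trans ?_
        rw [← ha, ← hr]
        rfl

/-- A path in the superlevel set is a chain of single moves, each of which preserves the class in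
the quotient. -/
theorem mk_sliceNode_eq {q q' : SurgeredPoint Γ m₀ t} (e : q.rootNode = q'.rootNode) :
    Quot.mk ((Γ.slices W ε m₀ t).Glue (Γ.glue W ε m₀ t)) (q.sliceNode hneg ht W ε) =
      Quot.mk ((Γ.slices W ε m₀ t).Glue (Γ.glue W ε m₀ t)) (q'.sliceNode hneg ht W ε) := by
  obtain ⟨hh, hL⟩ := rootNode_eq_iff.mp e
  have key := PlumbingGraph.component_induction (p := fun L => ∀ q' : SurgeredPoint Γ m₀ t,
    q.h = q'.h → q'.L = L →
    Quot.mk ((Γ.slices W ε m₀ t).Glue (Γ.glue W ε m₀ t)) (q.sliceNode hneg ht W ε) =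
      Quot.mk ((Γ.slices W ε m₀ t).Glue (Γ.glue W ε m₀ t)) (q'.sliceNode hneg ht W ε))
    ?_ ?_ ?_ hL
  · exact key q' hh rfl
  · rintro ⟨h, L, h1, h2⟩ hh hL
    obtain rfl : q.h = h := hh
    obtain rfl : L = q.L := hL
    rfl
  · intro L v h1 h2 ih q' hh hL
    rw [ih ⟨q.h, L, q.h_mem, h1⟩ rfl rfl]
    exact mk_sliceNode_add_single hneg ht W ε hh v hL
  · intro L v h1 h2 ih q' hh hL
    rw [ih ⟨q.h, _, q.h_mem, h2⟩ rfl rfl]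
    exact (mk_sliceNode_add_single hneg ht W ε (q' := ⟨q.h, _, q.h_mem, h2⟩) hh.symm v
      (by rw [hL])).symm

end SurgeredPoint

/-! ### Edges of the slices and edges of the surgered root. -/

theorem slices_adj {W : ℕ → ℤ → R} {ε : ℤ} {x y : (Γ.slices W ε m₀ t).Node} :
    (Γ.slices W ε m₀ t).graph.Adj x y ↔
      ∃ (a : Γ.alexSet m₀ t) (η η' : Γ.ambient.rootNodes (Γ.spincAt m₀ t a)),
        x = ⟨a, η⟩ ∧ y = ⟨a, η'⟩ ∧ (Γ.rootAt W ε m₀ t a).graph.Adj η η' := by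
  refine SimpleGraph.iSup_adj.trans (exists_congr fun a => ?_)
  refine (SimpleGraph.map_adj' _ _ _ _).trans ?_
  constructor
  · rintro ⟨_, η, η', ha, rfl, rfl⟩
    exact ⟨η, η', rfl, rfl, ha⟩
  · rintro ⟨η, η', rfl, rfl, ha⟩
    refine ⟨fun e => ha.ne ?_, η, η', ha, rfl, rfl⟩
    exact eq_of_heq (Sigma.mk.inj e).2

namespace SurgeredPoint

variable (hneg : (Γ.surgered m₀).IsNegDef) (ht : t ∈ (Γ.surgered m₀).SpinC)
  (W : ℕ → ℤ → R) (ε : ℤ)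

theorem rootNode_adj_of_slices_adj {q q' : SurgeredPoint Γ m₀ t}
    (e : (Γ.slices W ε m₀ t).graph.Adj (q.sliceNode hneg ht W ε) (q'.sliceNode hneg ht W ε)) :
    ((Γ.surgered m₀).weightedRoot W ε t).graph.Adj q.rootNode q'.rootNode := by
  have key : ∀ q q' : SurgeredPoint Γ m₀ t, q.alex = q'.alex →
      q'.h + sigmaShift (Γ.p m₀) q'.alex = q.h + sigmaShift (Γ.p m₀) q.alex - 2 →
      q.sliceComponent ⊆ q'.sliceComponent →
      q'.h = q.h - 2 ∧ q.rootNode.1.2 ⊆ q'.rootNode.1.2 := by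
    intro q q' ha hh hC
    have hh' : q'.h = q.h - 2 := by rw [ha] at hh; linarith
    refine ⟨hh', ?_⟩
    have hm := mem_component_of_restrict_mem hneg ht q'.L_mem.1 q.L_mem.1 ha
      (hC (q.restrict_mem_sliceComponent hneg))
    change (Γ.surgered m₀).component _ _ ⊆ (Γ.surgered m₀).component _ _
    rw [← PlumbingGraph.component_eq hm]
    exact PlumbingGraph.component_mono (PlumbingGraph.superlevel_anti (by linarith))
  obtain ⟨a, η, η', h1, h2, hadj⟩ := slices_adj.mp e
  have ha : q.alex = a := congrArg (fun x => (x.1 : ℚ)) h1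
  have ha' : q'.alex = a := congrArg (fun x => (x.1 : ℚ)) h2
  have hη : (q.h + sigmaShift (Γ.p m₀) q.alex, q.sliceComponent) = η.1 :=
    congrArg (fun x : (Γ.slices W ε m₀ t).Node =>
      (x.2 : Γ.ambient.rootNodes (Γ.spincAt m₀ t x.1)).1) h1
  have hη' : (q'.h + sigmaShift (Γ.p m₀) q'.alex, q'.sliceComponent) = η'.1 :=
    congrArg (fun x : (Γ.slices W ε m₀ t).Node =>
      (x.2 : Γ.ambient.rootNodes (Γ.spincAt m₀ t x.1)).1) h2
  have hadj := PlumbingGraph.root_adj.mp hadj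
  rw [← hη, ← hη'] at hadj
  refine PlumbingGraph.root_adj.mpr ?_
  exact hadj.imp (fun h => key q q' (ha.trans ha'.symm) h.1 h.2)
    (fun h => key q' q (ha'.trans ha.symm) h.1 h.2)

/-- The lattice point of the upper node, viewed one level lower, gives an edge inside its own slice,
where the shift σ(a) is constant. -/
theorem exists_slices_adj {q q' : SurgeredPoint Γ m₀ t}
    (e : ((Γ.surgered m₀).weightedRoot W ε t).graph.Adj q.rootNode q'.rootNode) :
    ∃ q₁ q₂ : SurgeredPoint Γ m₀ t,
      (Γ.slices W ε m₀ t).graph.Adj (q₁.sliceNode hneg ht W ε) (q₂.sliceNode hneg ht W ε) ∧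
        q₁.rootNode = q.rootNode ∧ q₂.rootNode = q'.rootNode := by
  have key : ∀ q q' : SurgeredPoint Γ m₀ t,
      q'.h = q.h - 2 → q.rootNode.1.2 ⊆ q'.rootNode.1.2 →
      ∃ q₁ q₂ : SurgeredPoint Γ m₀ t,
      (Γ.slices W ε m₀ t).graph.Adj (q₁.sliceNode hneg ht W ε) (q₂.sliceNode hneg ht W ε) ∧
        q₁.rootNode = q.rootNode ∧ q₂.rootNode = q'.rootNode := by
    intro q q' hh hC
    have hm : q.L ∈ (Γ.surgered m₀).component ((Γ.surgered m₀).superlevel t q'.h) q'.L :=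
      hC (PlumbingGraph.mem_component_self q.L_mem)
    let q₂ : SurgeredPoint Γ m₀ t := ⟨q'.h, q.L, q'.h_mem, hm.2.1⟩
    refine ⟨q, q₂, ?_, rfl, (rootNode_eq_iff (q := q') (q' := q₂).mpr ⟨rfl, hm⟩).symm⟩
    refine slices_adj.mpr ⟨⟨q.alex, alex_mem_alexSet q.L_mem.1⟩, q.ambientNode hneg ht,
      q₂.ambientNode hneg ht, rfl, rfl, PlumbingGraph.root_adj.mpr (Or.inl ⟨?_, ?_⟩)⟩
    · change q'.h + sigmaShift (Γ.p m₀) q.alex = q.h + sigmaShift (Γ.p m₀) q.alex - 2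
      rw [hh]; ring
    · refine PlumbingGraph.component_mono (PlumbingGraph.superlevel_anti ?_)
      change q'.h + sigmaShift (Γ.p m₀) q.alex ≤ q.h + sigmaShift (Γ.p m₀) q.alex
      linarith
  rcases PlumbingGraph.root_adj.mp e with h | h
  · exact key q q' h.1 h.2
  · obtain ⟨q₁, q₂, h1, h2, h3⟩ := key q' q h.1 h.2
    exact ⟨q₂, q₁, h1.symm, h3, h2⟩

end SurgeredPoint

variable (hneg : (Γ.surgered m₀).IsNegDef) (ht : t ∈ (Γ.surgered m₀).SpinC)
  (W : ℕ → ℤ → R) (ε : ℤ)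

/-- As a graph, the output of the algorithm is the graded root of the surgered graph. -/
theorem exists_algorithmRoot_graph_iso :
    ∃ φ : (Γ.algorithmRoot W ε m₀ t).graph ≃g ((Γ.surgered m₀).weightedRoot W ε t).graph,
      ∀ q : SurgeredPoint Γ m₀ t, φ (Quot.mk _ (q.sliceNode hneg ht W ε)) = q.rootNode :=
  SimpleGraph.exists_quot_iso (Γ.slices W ε m₀ t).graph
    ((Γ.surgered m₀).weightedRoot W ε t).graph
    ((Γ.slices W ε m₀ t).Glue (Γ.glue W ε m₀ t))
    (SurgeredPoint.sliceNode hneg ht W ε) SurgeredPoint.rootNode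
    (SurgeredPoint.sliceNode_surjective hneg ht W ε) SurgeredPoint.rootNode_surjective
    (fun q q' e => by
      obtain ⟨h1, h2, h3⟩ := (SurgeredPoint.sliceNode_eq_iff hneg ht W ε).mp e
      exact SurgeredPoint.rootNode_eq_of_mem_sliceComponent hneg ht h1 h2 h3)
    (fun q q' e => SurgeredPoint.rootNode_eq_of_glue hneg ht W ε e)
    (fun q q' e => SurgeredPoint.mk_sliceNode_eq hneg ht W ε e)
    (fun q q' e => SurgeredPoint.exists_slices_adj hneg ht W ε e)
    (fun q q' e _ => SurgeredPoint.rootNode_adj_of_slices_adj hneg ht W ε e)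

include hneg ht in
theorem SurgeredPoint.mk_sliceNode_eq_iff {q q' : SurgeredPoint Γ m₀ t} :
    Quot.mk ((Γ.slices W ε m₀ t).Glue (Γ.glue W ε m₀ t)) (q.sliceNode hneg ht W ε) =
      Quot.mk ((Γ.slices W ε m₀ t).Glue (Γ.glue W ε m₀ t)) (q'.sliceNode hneg ht W ε) ↔
    q.rootNode = q'.rootNode := by
  refine ⟨fun e => ?_, mk_sliceNode_eq hneg ht W ε⟩
  obtain ⟨φ, hφ⟩ := exists_algorithmRoot_graph_iso hneg ht W ε
  exact (hφ q).symm.trans ((congrArg φ e).trans (hφ q'))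

include hneg ht in
/-- Only finitely many nodes are identified with each other. -/
theorem finite_setOf_mk_eq (c : (Γ.algorithmRoot W ε m₀ t).Node) :
    {x : (Γ.slices W ε m₀ t).Node |
      Quot.mk ((Γ.slices W ε m₀ t).Glue (Γ.glue W ε m₀ t)) x = c}.Finite := by
  obtain ⟨y, rfl⟩ := Quot.exists_rep c
  obtain ⟨q, rfl⟩ := SurgeredPoint.sliceNode_surjective hneg ht W ε y
  -- All identified nodes share one grading, and each is represented by a point of the finite
  -- superlevel set there.
  have := (hneg.finite_superlevel t q.h).to_subtype
  refine (Set.finite_range fun L : (Γ.surgered m₀).superlevel t q.h =>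
    (⟨q.h, L, q.h_mem, L.2⟩ : SurgeredPoint Γ m₀ t).sliceNode hneg ht W ε).subset ?_
  intro x hx
  obtain ⟨q', rfl⟩ := SurgeredPoint.sliceNode_surjective hneg ht W ε x
  obtain ⟨hh, _⟩ := SurgeredPoint.rootNode_eq_iff.mp
    ((SurgeredPoint.mk_sliceNode_eq_iff hneg ht W ε).mp hx)
  obtain ⟨h, L, h1, h2⟩ := q'
  obtain rfl : h = q.h := hh
  exact ⟨⟨L, h2⟩, rfl⟩

end MarkedPlumbingGraph

/-! ## Weights -/

theorem finsum_mem_fun_apply {α β N : Type*} [AddCommMonoid N] {s : Set α} (hs : s.Finite)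
    (f : α → β → N) (e : β) : (∑ᶠ x ∈ s, f x) e = ∑ᶠ x ∈ s, f x e := by
  rw [finsum_mem_eq_finite_toFinset_sum _ hs, finsum_mem_eq_finite_toFinset_sum _ hs,
    Finset.sum_apply]

theorem finsum_mem_sub_distrib_of_finite {α N : Type*} [AddCommGroup N] {s : Set α} {f g : α → N}
    (hf : (s ∩ Function.support f).Finite) (hg : (s ∩ Function.support g).Finite) :
    ∑ᶠ x ∈ s, (f x - g x) = ∑ᶠ x ∈ s, f x - ∑ᶠ x ∈ s, g x := by
  rw [← Set.support_indicator] at hf hg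
  rw [finsum_mem_def, finsum_mem_def, finsum_mem_def, ← finsum_sub_distrib hf hg]
  exact finsum_congr fun x => congrFun (Set.indicator_sub s f g) x

/-- Summation over the fibres of a map. -/
theorem finsum_mem_fiberwise {α β N : Type*} [AddCommMonoid N] {s : Set α} {A : Set β}
    (f : α → N) (g : α → β) (hg : Set.MapsTo g s A) (hf : (s ∩ Function.support f).Finite) :
    {a | a ∈ A ∧ ∑ᶠ x ∈ {x ∈ s | g x = a}, f x ≠ 0}.Finite ∧
      ∑ᶠ x ∈ s, f x = ∑ᶠ a ∈ A, ∑ᶠ x ∈ {x ∈ s | g x = a}, f x := by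
  classical
  have hT : ∀ x, x ∈ hf.toFinset ↔ x ∈ s ∧ f x ≠ 0 := fun x => by simp
  have hfib : ∀ a, ∑ᶠ x ∈ {x ∈ s | g x = a}, f x = ∑ x ∈ hf.toFinset with g x = a, f x := by
    intro a
    refine finsum_mem_eq_sum_of_inter_support_eq _ ?_
    ext x
    simp only [Set.mem_inter_iff, Set.mem_ofPred_eq, Function.mem_support, Finset.coe_filter, hT]
    tauto
  have hsub : ∀ a, ∑ᶠ x ∈ {x ∈ s | g x = a}, f x ≠ 0 → a ∈ hf.toFinset.image g := by
    intro a ha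
    rw [hfib] at ha
    obtain ⟨x, hx, _⟩ := Finset.exists_ne_zero_of_sum_ne_zero ha
    rw [Finset.mem_filter] at hx
    exact Finset.mem_image.mpr ⟨x, hx.1, hx.2⟩
  refine ⟨(hf.toFinset.image g).finite_toSet.subset fun a ha => hsub a ha.2, ?_⟩
  have h1 : ∑ᶠ x ∈ s, f x = ∑ x ∈ hf.toFinset, f x := by
    refine finsum_mem_eq_sum_of_inter_support_eq _ ?_
    ext x
    simp only [Set.mem_inter_iff, Function.mem_support, Finset.mem_coe, hT]
    tauto
  have h2 : ∑ᶠ a ∈ A, ∑ᶠ x ∈ {x ∈ s | g x = a}, f x =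
      ∑ a ∈ hf.toFinset.image g, ∑ᶠ x ∈ {x ∈ s | g x = a}, f x := by
    refine finsum_mem_eq_sum_of_inter_support_eq _ ?_
    ext a
    constructor
    · exact fun ha => ⟨hsub a ha.2, ha.2⟩
    · rintro ⟨ha, ha'⟩
      obtain ⟨x, hx, rfl⟩ := Finset.mem_image.mp ha
      exact ⟨hg ((hT x).mp hx).1, ha'⟩
  rw [h1, h2, Finset.sum_congr rfl fun a _ => hfib a]
  exact (Finset.sum_fiberwise_of_maps_to (fun x hx => Finset.mem_image_of_mem g hx) f).symm

namespace PlumbingGraph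

variable {V : Type u} [Fintype V] [DecidableEq V] (P : PlumbingGraph V) {R : Type v} [CommRing R]

theorem compWeight_eq (W : ℕ → ℤ → R) (ε : ℤ) {C : Set (V → ℤ)} (hC : C.Finite) :
    P.compWeight W ε C = ∑ᶠ K ∈ C, P.term W ε K := by
  ext e
  rw [finsum_mem_fun_apply hC, compWeight]

end PlumbingGraph

/-! ### Matching weights and series through the Laplace transform. -/

namespace MarkedPlumbingGraph

variable {ι : Type u} [Fintype ι] [DecidableEq ι] {Γ : MarkedPlumbingGraph ι} {m₀ : ℤ}
  {t : Set (Option ι → ℤ)} {R : Type v} [CommRing R] {W : ℕ → ℤ → R} {ε : ℤ}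

theorem laplace_compWeight (p a : ℚ) {C : Set (ι → ℤ)} (hC : C.Finite) :
    laplace p a ε (Γ.compWeight W ε C) = ∑ᶠ K ∈ C, laplace p a ε (Γ.term W ε K) := by
  ext e
  rw [finsum_mem_fun_apply hC]
  simp only [laplace, Pi.sub_apply, QT.shift, compWeight]
  rw [finsum_mem_sub_distrib _ _ hC]

/-- This produces the shift by (1 + ε)p/2 in the transform: for ℓ = L - εMu one gets ℓ·Σ = 2a - p -
εp. -/
theorem Mu_dotProduct_Sig (hneg : (Γ.surgered m₀).IsNegDef) :
    toQ (Γ.surgered m₀).Mu ⬝ᵥ Γ.Sig = Γ.p m₀ := by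
  have := mulVec_dotProduct_Sig hneg (toQ (1 : Option ι → ℤ))
  rw [PlumbingGraph.Mu, toQ_mulVec]
  refine this.trans ?_
  simp [toQ]

/-- The summands of the weights are matched by the Laplace transform. -/
theorem laplace_term (hneg : (Γ.surgered m₀).IsNegDef) (hW : IsAdmissible W)
    (hε : ε = 1 ∨ ε = -1) (L : Option ι → ℤ) :
    laplace (Γ.p m₀) (Γ.alex m₀ L) ε (Γ.term W ε (restrictΓ L)) =
      (Γ.surgered m₀).term W ε L := by
  have hr : restrictΓ L - ε • (Γ.ambient.Mu + Γ.lam) =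
      restrictΓ (L - ε • (Γ.surgered m₀).Mu) := by
    ext i
    simp [restrictΓ, surgered_Mu_some, mul_add]
  rw [term_eq_latticeTerm (ambient_isNegDef hneg) W hε, PlumbingGraph.term_eq_latticeTerm, hr]
  refine laplace_latticeTerm hneg hW ?_
  rw [toQ_sub, toQ_zsmul, sub_dotProduct, smul_dotProduct, Mu_dotProduct_Sig hneg, alex, smul_eq_mul]
  ring

/-- The lattice points of the surgered graph that lie over a node of a slice. -/
def sliceFiber (x : (Γ.slices W ε m₀ t).Node) : Set (Option ι → ℤ) :=
  {L ∈ t | Γ.alex m₀ L = x.1 ∧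
    restrictΓ L ∈ (x.2 : Γ.ambient.rootNodes (Γ.spincAt m₀ t x.1)).1.2}

section

variable (hneg : (Γ.surgered m₀).IsNegDef) (ht : t ∈ (Γ.surgered m₀).SpinC)

theorem SurgeredPoint.mem_sliceFiber_iff (q : SurgeredPoint Γ m₀ t) {L : Option ι → ℤ} :
    L ∈ sliceFiber (q.sliceNode hneg ht W ε) ↔
      L ∈ t ∧ Γ.alex m₀ L = q.alex ∧ restrictΓ L ∈ q.sliceComponent := Iff.rfl

include hneg ht

theorem SurgeredPoint.sliceFiber_subset (q : SurgeredPoint Γ m₀ t) :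
    sliceFiber (q.sliceNode hneg ht W ε) ⊆ q.rootNode.1.2 :=
  fun _ hL => mem_component_of_restrict_mem hneg ht q.L_mem.1 hL.1 hL.2.1 hL.2.2

/-- Restriction is a bijection from the fibre onto the component in the slice, and the summands
correspond by `laplace_term`. -/
theorem slices_weight_eq (hW : IsAdmissible W) (hε : ε = 1 ∨ ε = -1)
    (x : (Γ.slices W ε m₀ t).Node) :
    (Γ.slices W ε m₀ t).weight x = ∑ᶠ L ∈ sliceFiber x, (Γ.surgered m₀).term W ε L := by
  obtain ⟨q, rfl⟩ := SurgeredPoint.sliceNode_surjective hneg ht W ε x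
  have hfin : q.sliceComponent.Finite :=
    ((ambient_isNegDef hneg).finite_superlevel _ _).subset PlumbingGraph.component_subset
  refine Eq.trans (laplace_compWeight (Γ.p m₀) q.alex hfin) (Eq.symm ?_)
  refine finsum_mem_eq_of_bijOn restrictΓ ⟨fun L hL => hL.2.2, ?_, ?_⟩ ?_
  · exact fun L hL L' hL' e => eq_of_alex_eq Γ m₀ (hL.2.1.trans hL'.2.1.symm) e
  · intro K hK
    obtain ⟨L, hL, ha, rfl⟩ := exists_lift hneg ht (PlumbingGraph.component_subset hK).1
    exact ⟨L, ⟨hL, ha, hK⟩, rfl⟩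
  · intro L hL
    have ha : Γ.alex m₀ L = q.alex := hL.2.1
    rw [← ha]
    exact (laplace_term hneg hW hε L).symm

/-- The fibres over the slice nodes of one class partition the component of `q`, so adding their
weights is summing over that component. -/
theorem algorithmRoot_weight (hW : IsAdmissible W) (hε : ε = 1 ∨ ε = -1)
    (q : SurgeredPoint Γ m₀ t) :
    (Γ.algorithmRoot W ε m₀ t).weight (Quot.mk _ (q.sliceNode hneg ht W ε)) =
      (Γ.surgered m₀).compWeight W ε q.rootNode.1.2 := by
  set c : Quot ((Γ.slices W ε m₀ t).Glue (Γ.glue W ε m₀ t)) :=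
    Quot.mk _ (q.sliceNode hneg ht W ε) with hc
  set I : Set (Γ.slices W ε m₀ t).Node :=
    {x | Quot.mk ((Γ.slices W ε m₀ t).Glue (Γ.glue W ε m₀ t)) x = c} with hI
  have hIfin : I.Finite := finite_setOf_mk_eq hneg ht W ε c
  have hmem : ∀ q' : SurgeredPoint Γ m₀ t,
      q'.sliceNode hneg ht W ε ∈ I ↔ q'.rootNode = q.rootNode :=
    fun q' => SurgeredPoint.mk_sliceNode_eq_iff hneg ht W ε
  have hCfin : q.rootNode.1.2.Finite :=
    (hneg.finite_superlevel t q.h).subset PlumbingGraph.component_subset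
  have hsub : ∀ x ∈ I, sliceFiber x ⊆ q.rootNode.1.2 := by
    intro x hx
    obtain ⟨q', rfl⟩ := SurgeredPoint.sliceNode_surjective hneg ht W ε x
    rw [← (hmem q').mp hx]
    exact q'.sliceFiber_subset hneg ht
  have hunion : q.rootNode.1.2 = ⋃ x ∈ I, sliceFiber x := by
    apply le_antisymm
    · intro L hL
      let q' : SurgeredPoint Γ m₀ t := ⟨q.h, L, q.h_mem, PlumbingGraph.component_subset hL⟩
      have hq' : q'.sliceNode hneg ht W ε ∈ I :=
        (hmem q').mpr (SurgeredPoint.rootNode_eq_iff (q := q) (q' := q').mpr ⟨rfl, hL⟩).symm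
      exact Set.mem_biUnion hq' ((q'.mem_sliceFiber_iff hneg ht).mpr
        ⟨q'.L_mem.1, rfl, q'.restrict_mem_sliceComponent hneg⟩)
    · exact Set.iUnion₂_subset hsub
  -- A common point fixes the slice and the component in it; the grading is common to the whole
  -- class.
  have hdisj : I.PairwiseDisjoint sliceFiber := by
    intro x hx y hy hxy
    obtain ⟨q₁, rfl⟩ := SurgeredPoint.sliceNode_surjective hneg ht W ε x
    obtain ⟨q₂, rfl⟩ := SurgeredPoint.sliceNode_surjective hneg ht W ε y
    refine Set.disjoint_left.mpr fun L h1 h2 => hxy ?_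
    rw [SurgeredPoint.mem_sliceFiber_iff] at h1 h2
    have e1 := (SurgeredPoint.rootNode_eq_iff.mp ((hmem q₁).mp hx)).1
    have e2 := (SurgeredPoint.rootNode_eq_iff.mp ((hmem q₂).mp hy)).1
    have hh : q₁.h = q₂.h := e1.trans e2.symm
    have ha : q₂.alex = q₁.alex := h2.2.1.symm.trans h1.2.1
    refine (SurgeredPoint.sliceNode_eq_iff hneg ht W ε).mpr ⟨ha, hh, ?_⟩
    have h1' := h1.2.2
    have h2' := h2.2.2
    unfold SurgeredPoint.sliceComponent at h1' h2' ⊢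
    rw [ha, ← hh] at h2'
    rw [← PlumbingGraph.component_eq h1']
    exact PlumbingGraph.mem_component_comm h2'
  rw [PlumbingGraph.compWeight_eq _ _ _ hCfin, hunion,
    finsum_mem_biUnion hdisj hIfin fun x hx => hCfin.subset (hsub x hx)]
  exact finsum_mem_congr rfl fun x _ => slices_weight_eq hneg ht hW hε x

/-- The output of the algorithm is the weighted graded root of the surgered graph. -/
theorem nonempty_algorithmRoot_iso (hW : IsAdmissible W) (hε : ε = 1 ∨ ε = -1) :
    Nonempty ((Γ.algorithmRoot W ε m₀ t).Iso ((Γ.surgered m₀).weightedRoot W ε t)) := by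
  obtain ⟨φ, hφ⟩ := exists_algorithmRoot_graph_iso hneg ht W ε
  have hrep : ∀ c : (Γ.algorithmRoot W ε m₀ t).Node, ∃ q : SurgeredPoint Γ m₀ t,
      c = Quot.mk _ (q.sliceNode hneg ht W ε) := by
    rintro ⟨x⟩
    obtain ⟨q, rfl⟩ := SurgeredPoint.sliceNode_surjective hneg ht W ε x
    exact ⟨q, rfl⟩
  refine ⟨⟨φ, fun c => ?_, fun c => ?_⟩⟩
  · obtain ⟨q, rfl⟩ := hrep c
    exact (congrArg ((Γ.surgered m₀).weightedRoot W ε t).grading (hφ q)).trans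
      (SurgeredPoint.grading_sliceNode hneg ht W ε q).symm
  · obtain ⟨q, rfl⟩ := hrep c
    exact (congrArg ((Γ.surgered m₀).weightedRoot W ε t).weight (hφ q)).trans
      (algorithmRoot_weight hneg ht hW hε q).symm

end

/-! ## The series -/

section Series

variable {b : ι → ℤ}

theorem Zhat_apply (r : ℚ) (e : ℚ × ℚ) :
    Γ.Zhat W b r e = ∑ᶠ l ∈ Γ.ambient.cls b, Γ.latticeTerm W l r e := rfl

theorem finite_support_latticeTerm (hΓ : Γ.ambient.IsNegDef) (S : Set (ι → ℤ)) (r : ℚ)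
    (e : ℚ × ℚ) : (S ∩ Function.support fun l => Γ.latticeTerm W l r e).Finite := by
  refine (hΓ.finite_sq_ge
    (-(4 * e.1 + (3 * Fintype.card ι + (∑ i, (Γ.weight i : ℚ)) + Γ.sf)))).subset fun l hl => ?_
  exact not_lt.mp fun hlt => hl.2 (Γ.latticeTerm_apply_of_ne W l r hlt)

/-- The class is infinite, so linearity is used one coefficient at a time, where the support is
finite. -/
theorem laplace_Zhat_apply (hΓ : Γ.ambient.IsNegDef) (p a : ℚ) (e : ℚ × ℚ) :
    laplace p a ε (Γ.Zhat W b) e =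
      ∑ᶠ l ∈ Γ.ambient.cls b, laplace p a ε (Γ.latticeTerm W l) e := by
  simp only [laplace, Pi.sub_apply, QT.shift, Zhat_apply]
  rw [finsum_mem_sub_distrib_of_finite (finite_support_latticeTerm hΓ _ _ _)
    (finite_support_latticeTerm hΓ _ _ _)]

/-- If the ambient lattice is unimodular, it has a single spin^c structure. -/
theorem cls_eq_of_isUnit_det (hdet : IsUnit Γ.ambient.M.det) (b : ι → ℤ) :
    Γ.ambient.cls b = {l | ∃ x : ι → ℤ, l = b + 2 • x} := by
  ext l
  constructor
  · rintro ⟨x, rfl⟩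
    exact ⟨_, rfl⟩
  · rintro ⟨x, rfl⟩
    refine ⟨Γ.ambient.M⁻¹ *ᵥ x, ?_⟩
    rw [Matrix.mulVec_mulVec, Matrix.mul_nonsing_inv _ hdet, Matrix.one_mulVec]

/-- Changing the sign of `Mu` moves by 2Mu, which stays in the class. This lets the index set be
sliced by a(ℓ + εMu) for either sign. -/
theorem add_Mu_mem_iff (ht : t ∈ (Γ.surgered m₀).SpinC) (hε : ε = 1 ∨ ε = -1)
    (l : Option ι → ℤ) :
    l + (Γ.surgered m₀).Mu ∈ t ↔ l + ε • (Γ.surgered m₀).Mu ∈ t := by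
  rcases hε with rfl | rfl
  · rw [one_smul]
  · constructor
    · intro h
      have := PlumbingGraph.add_mem_of_mem_SpinC ht h (-1)
      rw [Matrix.mulVec_neg] at this
      convert this using 1
      simp only [PlumbingGraph.Mu]
      module
    · intro h
      have := PlumbingGraph.add_mem_of_mem_SpinC ht h 1
      convert this using 1
      simp only [PlumbingGraph.Mu]
      module

variable (hneg : (Γ.surgered m₀).IsNegDef) (ht : t ∈ (Γ.surgered m₀).SpinC)
include hneg ht

/-- If the ambient lattice is unimodular, every slice of the index set of the series of the
surgered graph is the index set of the series of the complement. -/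
theorem bijOn_restrict (hε : ε = 1 ∨ ε = -1) (hdet : IsUnit Γ.ambient.M.det)
    (hb : ∃ x : ι → ℤ, b = (fun i => (Γ.deg (some i) : ℤ)) + 2 • x) {a : ℚ}
    (ha : a ∈ Γ.alexSet m₀ t) :
    Set.BijOn restrictΓ
      {l ∈ {l | l + (Γ.surgered m₀).Mu ∈ t} | Γ.alex m₀ (l + ε • (Γ.surgered m₀).Mu) = a}
      (Γ.ambient.cls b) := by
  obtain ⟨y, rfl⟩ := hb
  rw [cls_eq_of_isUnit_det hdet]
  have hMu : ∀ i, (Γ.surgered m₀).Mu (some i) = Γ.weight i + Γ.deg (some i) :=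
    fun i => PlumbingGraph.Mu_apply _ _
  refine ⟨?_, ?_, ?_⟩
  · rintro l ⟨hl, -⟩
    obtain ⟨x, hx⟩ := PlumbingGraph.mem_Char_of_mem_SpinC ht hl
    refine ⟨fun i => x (some i) - Γ.deg (some i) - y i, ?_⟩
    ext i
    have h1 := congrFun hx (some i)
    have h2 : (Γ.surgered m₀).weight (some i) = Γ.weight i := rfl
    simp only [Pi.add_apply, Pi.smul_apply, hMu, h2, restrictΓ] at h1 ⊢
    simp only [nsmul_eq_mul, Nat.cast_ofNat] at h1 ⊢
    linarith
  · rintro l ⟨-, hl⟩ l' ⟨-, hl'⟩ e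
    refine add_right_cancel (b := ε • (Γ.surgered m₀).Mu)
      (eq_of_alex_eq Γ m₀ (hl.trans hl'.symm) ?_)
    ext i
    have := congrFun e i
    simp only [restrictΓ, Pi.add_apply] at this ⊢
    rw [this]
  · rintro l ⟨x, rfl⟩
    obtain ⟨L, hL, rfl⟩ := ha
    obtain ⟨z, hz⟩ := PlumbingGraph.mem_Char_of_mem_SpinC ht hL
    set l : ι → ℤ := (fun i => (Γ.deg (some i) : ℤ)) + 2 • y + 2 • x with hl
    -- By unimodularity, membership in the slice is a parity condition, and both vectors are
    -- congruent to the weights modulo 2; the witness depends on whether the degrees double or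
    -- cancel.
    have hmem : l + ε • restrictΓ (Γ.surgered m₀).Mu ∈ Γ.spincAt m₀ t (Γ.alex m₀ L) := by
      rw [spincAt_eq hneg ht hL, cls_eq_of_isUnit_det hdet]
      have hz' : ∀ i, L (some i) = Γ.weight i + 2 * z (some i) := fun i => by
        rw [hz]
        simp [surgered]
      rcases hε with rfl | rfl
      · refine ⟨fun i => Γ.deg (some i) + y i + x i - z (some i), ?_⟩
        ext i
        simp only [hl, Pi.add_apply, Pi.smul_apply, hMu, hz', restrictΓ]
        simp only [smul_eq_mul, nsmul_eq_mul, Nat.cast_ofNat]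
        ring
      · refine ⟨fun i => y i + x i - z (some i) - Γ.weight i, ?_⟩
        ext i
        simp only [hl, Pi.add_apply, Pi.smul_apply, hMu, hz', restrictΓ]
        simp only [smul_eq_mul, nsmul_eq_mul, Nat.cast_ofNat]
        ring
    obtain ⟨L', hL', ha', hr'⟩ := exists_lift hneg ht hmem
    have e : L' - ε • (Γ.surgered m₀).Mu + ε • (Γ.surgered m₀).Mu = L' := sub_add_cancel _ _
    refine ⟨L' - ε • (Γ.surgered m₀).Mu, ⟨?_, by rw [e, ha']⟩, ?_⟩
    · refine (add_Mu_mem_iff ht hε _).mpr ?_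
      rwa [e]
    · change restrictΓ L' - ε • restrictΓ (Γ.surgered m₀).Mu = l
      rw [hr', add_sub_cancel_right]

/-- The surgery formula for the series. -/
theorem Zhat_surgery (hW : IsAdmissible W) (hε : ε = 1 ∨ ε = -1)
    (hdet : IsUnit Γ.ambient.M.det)
    (hb : ∃ x : ι → ℤ, b = (fun i => (Γ.deg (some i) : ℤ)) + 2 • x) (e : ℚ × ℚ) :
    {a | a ∈ Γ.alexSet m₀ t ∧ laplace (Γ.p m₀) a ε (Γ.Zhat W b) e ≠ 0}.Finite ∧
      (Γ.surgered m₀).Zhat W t e =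
        ∑ᶠ a ∈ Γ.alexSet m₀ t, laplace (Γ.p m₀) a ε (Γ.Zhat W b) e := by
  have hslice : ∀ a ∈ Γ.alexSet m₀ t, laplace (Γ.p m₀) a ε (Γ.Zhat W b) e =
      ∑ᶠ l ∈ {l ∈ {l | l + (Γ.surgered m₀).Mu ∈ t} |
        Γ.alex m₀ (l + ε • (Γ.surgered m₀).Mu) = a}, (Γ.surgered m₀).latticeTerm W l e := by
    intro a ha
    rw [laplace_Zhat_apply (ambient_isNegDef hneg)]
    refine (finsum_mem_eq_of_bijOn restrictΓ (bijOn_restrict hneg ht hε hdet hb ha) ?_).symm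
    rintro l ⟨-, hl⟩
    rw [laplace_latticeTerm hneg hW]
    rw [alex, toQ_add, toQ_zsmul, add_dotProduct, smul_dotProduct, Mu_dotProduct_Sig hneg,
      smul_eq_mul] at hl
    linarith
  have hfin : ({l | l + (Γ.surgered m₀).Mu ∈ t} ∩
      Function.support fun l => (Γ.surgered m₀).latticeTerm W l e).Finite := by
    refine (hneg.finite_sq_ge (-(4 * e.1 + (3 * Fintype.card (Option ι) +
      (∑ v, ((Γ.surgered m₀).weight v : ℚ)))))).subset fun l hl => ?_
    exact not_lt.mp fun hlt => hl.2 ((Γ.surgered m₀).latticeTerm_apply_of_ne W l hlt)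
  -- The lattice points are sorted by a(ℓ + εMu). Only finitely many contribute to the coefficient
  -- `e`, which also bounds the set of contributing a.
  obtain ⟨h1, h2⟩ := finsum_mem_fiberwise
    (s := {l | l + (Γ.surgered m₀).Mu ∈ t}) (fun l => (Γ.surgered m₀).latticeTerm W l e)
    (fun l => Γ.alex m₀ (l + ε • (Γ.surgered m₀).Mu))
    (fun l hl => alex_mem_alexSet ((add_Mu_mem_iff ht hε l).mp hl)) hfin
  refine ⟨h1.subset fun a ha => ⟨ha.1, ?_⟩, h2.trans ?_⟩
  · rw [← hslice a ha.1]
    exact ha.2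
  · exact finsum_mem_congr rfl fun a ha => (hslice a ha).symm

end Series

end MarkedPlumbingGraph

end

theorem theorem4p4 {ι : Type*} [Fintype ι] [DecidableEq ι] (Γ : MarkedPlumbingGraph ι) (m₀ : ℤ)
    (hneg : (Γ.surgered m₀).IsNegDef) {R : Type*} [CommRing R] (W : ℕ → ℤ → R)
    (hW : IsAdmissible W) (ε : ℤ) (hε : ε = 1 ∨ ε = -1)
    (t : Set (Option ι → ℤ)) (ht : t ∈ (Γ.surgered m₀).SpinC) :
    -- the weighted graded roots used as input are the collapses of the weighted bigraded roots
    (∀ a : Γ.alexSet m₀ t,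
      ∃ φ : (Γ.bigradedRootAt W ε m₀ t a).collapseU.Iso (Γ.rootAt W ε m₀ t a),
        ∀ ν : (Γ.bigradedRootAt W ε m₀ t a).Node,
          (φ.toIso (Quot.mk _ ν)).1 = (Γ.coordinate (Γ.spincAt m₀ t a) ν.1).1) ∧
    -- only finitely many nodes are identified with each other, so that weights can be added up
    (∀ c : (Γ.algorithmRoot W ε m₀ t).Node,
      {x : (Γ.slices W ε m₀ t).Node |
        Quot.mk ((Γ.slices W ε m₀ t).Glue (Γ.glue W ε m₀ t)) x = c}.Finite) ∧
    -- the output of the algorithm is the weighted graded root of the surgered graph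
    Nonempty ((Γ.algorithmRoot W ε m₀ t).Iso ((Γ.surgered m₀).weightedRoot W ε t)) ∧
    -- the surgery formula for the series, when the ambient manifold is an integer homology sphere
    (IsUnit Γ.ambient.M.det →
      ∀ b : ι → ℤ, (∃ x : ι → ℤ, b = (fun i => (Γ.deg (some i) : ℤ)) + 2 • x) →
        ∀ e : ℚ × ℚ,
          {a | a ∈ Γ.alexSet m₀ t ∧ laplace (Γ.p m₀) a ε (Γ.Zhat W b) e ≠ 0}.Finite ∧
          (Γ.surgered m₀).Zhat W t e =
            ∑ᶠ a ∈ Γ.alexSet m₀ t, laplace (Γ.p m₀) a ε (Γ.Zhat W b) e) := by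
  refine ⟨fun a => ?_, fun c => ?_, ?_, fun hdet b hb e => ?_⟩
  · exact MarkedPlumbingGraph.exists_collapseU_iso W ε
      (MarkedPlumbingGraph.ambient_isNegDef hneg)
      (MarkedPlumbingGraph.spincAt_mem_SpinC hneg ht a.2)
  · exact MarkedPlumbingGraph.finite_setOf_mk_eq hneg ht W ε c
  · exact MarkedPlumbingGraph.nonempty_algorithmRoot_iso hneg ht hW hε
  · exact MarkedPlumbingGraph.Zhat_surgery hneg ht hW hε hdet hb e
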